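/- Let $N, I_1,\dots,I_N$ be positive integers and $r = I_1\cdots I_N$. A square tensor $\mathcal H\in\mathbb C^{I_1\times\cdots\times I_N\times I_1\times\cdots\times I_N}$ is multiplied by the Einstein product $(\mathcal X\star_N\mathcal Y)_{\mathbf i,\mathbf k}=\sum_{\mathbf j}x_{\mathbf i,\mathbf j}\,y_{\mathbf j,\mathbf k}$ (sum over multi-indices $\mathbf j=(j_1,\dots,j_N)$) and has conjugate transpose $(\mathcal X^H)_{\mathbf j,\mathbf i}=\overline{x_{\mathbf i,\mathbf j}}$. For a Hermitian tensor $\mathcal H$ let $\lambda_1(\mathcal H)\ge\cdots\ge\lambda_r(\mathcal H)$ be its eigenvalues with multiplicity, in decreasing order; $\mathcal H$ is nonnegative if all of them are $\ge 0$, and for a real function $f$ the tensor $f(\mathcal H)$ is given by the functional calculus. A unitarily invariant norm is a norm $\|\cdot\|_\rho$ on this space of tensors with $\|\mathcal H\star_N\mathcal U\|_\rho=\|\mathcal U\star_N\mathcal H\|_\rho=\|\mathcal H\|_\rho$ for every tensor $\mathcal H$ and every unitary tensor $\mathcal U$. Let $\Omega$ be a $\sigma$-compact metric space, $\nu$ a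 probability measure on its Borel $\sigma$-field, $\mathcal C$ a nonnegative Hermitian tensor, and $\tau\mapsto\mathcal D_\tau$ a continuous map from $\Omega$ to the nonnegative Hermitian tensors with $\sup_{\tau\in\Omega}\|\mathcal D_\tau\|<\infty$. Use the conventions $\log 0=-\infty$ and $e^{-\infty}=0$; integrals of logarithms may take the value $-\infty$. Then the following three statements are equivalent: 1. $\vec\lambda(\mathcal C)\prec_{w\log}\exp\int_\Omega\log\vec\lambda(\mathcal D_\tau)\,d\nu(\tau)$, that is, for every $k\in\{1,\dots,r\}$, $$\prod_{i=1}^k\lambda_i(\mathcal C)\le\prod_{i=1}^k\exp\int_\Omega\log\lambda_i(\mathcal D_\tau)\,d\nu(\tau).$$ 2. For every continuous function $f:[0,\infty)\to[0,\infty)$ such that $x\mapsto\log f(e^x)$ is convex on $\mathbb R$ (with values in $[-\infty,\infty)$), and for every unitarily invariant norm $\|\cdot\|_\rho$, $$\|f(\mathcal C)\|_\rho\le\exp\int_\Omega\log\|f(\mathcal D_\tau)\|_\rho\,d\nu(\tau).$$ 3. For every continuous function $g:[0,\infty)\to[0,\infty)$ such that $x\mapsto g(e^x)$ is convex on $\mathbb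 R$, and for every unitarily invariant norm $\|\cdot\|_\rho$, $$\|g(\mathcal C)\|_\rho\le\int_\Omega\|g(\mathcal D_\tau)\|_\rho\,d\nu(\tau).$$ (Under the convexity conditions, continuity on $[0,\infty)$ with finite value at $0$ means the same as: continuous and non-decreasing on $(0,\infty)$, with $f(0)=\lim_{x\to0^+}f(x)$, and likewise for $g$.) -/

import Mathlib

open MeasureTheory Matrix
open scoped ENNReal ComplexOrder

/-- Square complex tensors in `ℂ^{I₁ × ⋯ × I_N × I₁ × ⋯ × I_N}`: arrays with two groups of `N`
indices.  As matrices over multi-indices, the Einstein product is `*`, the conjugate transpose is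
`ᴴ` and the identity tensor is `1`. -/
abbrev SquareTensor {N : ℕ} (I : Fin N → ℕ) : Type :=
  Matrix ((j : Fin N) → Fin (I j)) ((j : Fin N) → Fin (I j)) ℂ

/-- The number `r = I₁ ⋯ I_N` of Hermitian eigenvalues, counted with multiplicity. -/
abbrev tensorDim {N : ℕ} (I : Fin N → ℕ) : ℕ :=
  Fintype.card ((j : Fin N) → Fin (I j))

/-- The Frobenius norm `√⟨X, X⟩ = √Tr(Xᴴ X)`. -/
noncomputable def frobeniusNorm {N : ℕ} {I : Fin N → ℕ} (X : SquareTensor I) : ℝ :=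
  √((Xᴴ * X).trace.re)

/-- The decreasing vector `λ₁(H) ≥ ⋯ ≥ λ_r(H)` of eigenvalues of a nonnegative Hermitian tensor. -/
noncomputable def eigenvalueVector {N : ℕ} {I : Fin N → ℕ} {H : SquareTensor I}
    (hH : H.PosSemidef) : Fin (tensorDim I) → ℝ :=
  hH.isHermitian.eigenvalues₀

/-- A unitarily invariant norm on square tensors. -/
structure IsUnitarilyInvariantNorm {N : ℕ} {I : Fin N → ℕ}
    (ρ : Seminorm ℂ (SquareTensor I)) : Prop where
  eq_zero_of_map_eq_zero : ∀ H : SquareTensor I, ρ H = 0 → H = 0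
  map_mul_unitary : ∀ H U : SquareTensor I,
    U ∈ Matrix.unitaryGroup ((j : Fin N) → Fin (I j)) ℂ → ρ (H * U) = ρ H
  map_unitary_mul : ∀ H U : SquareTensor I,
    U ∈ Matrix.unitaryGroup ((j : Fin N) → Fin (I j)) ℂ → ρ (U * H) = ρ H

/-- The logarithm of a nonnegative real number, with `log 0 = -∞`. -/
noncomputable def extLog (x : ℝ) : EReal :=
  ENNReal.log (ENNReal.ofReal x)

/-- The integral `∫ φ⁺ dν - ∫ φ⁻ dν` of an extended-real function; it is meaningful as soon as one
of the two parts is finite, and may be infinite. -/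
noncomputable def extIntegral {Ω : Type*} [MeasurableSpace Ω] (ν : Measure Ω) (φ : Ω → EReal) :
    EReal :=
  ((∫⁻ τ, (φ τ).toENNReal ∂ν : ℝ≥0∞) : EReal) - ((∫⁻ τ, (-φ τ).toENNReal ∂ν : ℝ≥0∞) : EReal)

/-- The mapping `x ↦ log f(eˣ)` is convex on `ℝ`, as a function with values in `[-∞, ∞)`. -/
def ConvexLogExp (f : ℝ → ℝ) : Prop :=
  ∀ x y a b : ℝ, 0 < a → 0 < b → a + b = 1 →
    extLog (f (Real.exp (a * x + b * y))) ≤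
      (a : EReal) * extLog (f (Real.exp x)) + (b : EReal) * extLog (f (Real.exp y))

/-- Weak log-majorization between decreasingly ordered nonnegative vectors:
`x₁ ⋯ x_k ≤ y₁ ⋯ y_k` for all `k ≤ r`. -/
def WeakLogMajorized {r : ℕ} (x y : Fin r → ℝ≥0∞) : Prop :=
  ∀ k : ℕ, 1 ≤ k → k ≤ r →
    ∏ i : Fin r with i.val < k, x i ≤ ∏ i : Fin r with i.val < k, y i

/-! ### Partial sums over initial segments of `Fin r` -/

/-! A unitarily invariant norm sees `f(H)` only through the vector `f(λ(H))`, on which it acts as a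
symmetric gauge. At a decreasing nonnegative vector, Hahn–Banach, sign changes and rearrangement
give decreasing nonnegative weights `w` whose functional attains the gauge there and minorizes it
everywhere (`exists_weights`).

From 1: let `G i` be the geometric mean of `λ_i(D_τ)`. For `g` convex in the logarithm, weak
log-majorization bounds the partial sums of `g(λ_i(C))` by those of `g(G i)`, and Abel summation
inserts the weights `w`. Jensen, additive for 3 and multiplicative for 2, moves `g` inside the mean;
for 2 the weighted sum follows by superadditivity of the geometric mean (`geomMean_add_le`). The
same `w` serves every `τ`, so the result is bounded by the mean of the norms.

To 1: test on Ky Fan norms, which give sums of the largest eigenvalues. In 3 take `g x = log (1 + x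
/ ε)`; in 2 take `f x = (ε + x) ^ p` and let `p → 0`. Both yield `∑ log (ε + λ_i(C)) ≤ ∑ ∫ log (ε +
λ_i(D_τ))`, and `ε → 0` gives 1. The shift `ε` keeps all logarithms bounded until this last limit.
-/

lemma filter_val_lt_succ {r k : ℕ} (hk : k < r) :
    (Finset.univ.filter fun i : Fin r => i.val < k + 1) =
      insert ⟨k, hk⟩ (Finset.univ.filter fun i : Fin r => i.val < k) := by
  ext i
  simp only [Finset.mem_filter, Finset.mem_univ, true_and, Finset.mem_insert, Fin.ext_iff]
  omega

lemma sum_val_lt_succ {M : Type*} [AddCommMonoid M] {r k : ℕ} (hk : k < r) (x : Fin r → M) :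
    ∑ i : Fin r with i.val < k + 1, x i = ∑ i : Fin r with i.val < k, x i + x ⟨k, hk⟩ := by
  rw [filter_val_lt_succ hk, Finset.sum_insert (by simp), add_comm]

lemma card_val_lt {r k : ℕ} (hk : k ≤ r) :
    (Finset.univ.filter fun i : Fin r => i.val < k).card = k := by
  simp [Fin.card_filter_val_lt, hk]

/-- Abel summation: decreasing nonnegative weights preserve nonnegativity of partial sums. -/
lemma sum_mul_nonneg_of_partial_sums {r k : ℕ} (hk : k ≤ r) {w t : Fin r → ℝ}
    (hw : ∀ i j : Fin r, i ≤ j → j.val < k → w j ≤ w i) (hw0 : ∀ i : Fin r, i.val < k → 0 ≤ w i)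
    (ht : ∀ j ≤ k, 0 ≤ ∑ i : Fin r with i.val < j, t i) :
    0 ≤ ∑ i : Fin r with i.val < k, w i * t i := by
  -- Replacing the last weight by the next, smaller one only lowers the left side, because the
  -- partial sum it multiplies is nonnegative.
  have key : ∀ j, ∀ hj : j < k, w ⟨j, hj.trans_le hk⟩ * ∑ i : Fin r with i.val < j + 1, t i ≤
      ∑ i : Fin r with i.val < j + 1, w i * t i := by
    intro j
    induction j with
    | zero =>
      intro hj
      rw [sum_val_lt_succ (hj.trans_le hk), sum_val_lt_succ (hj.trans_le hk)]
      simp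
    | succ j ih =>
      intro hj
      rw [sum_val_lt_succ (hj.trans_le hk), sum_val_lt_succ (hj.trans_le hk)]
      have h1 := ih (by omega)
      have h2 := hw ⟨j, by omega⟩ ⟨j + 1, hj.trans_le hk⟩ (by simp [Fin.le_def]) hj
      have h3 := mul_le_mul_of_nonneg_right h2 (ht (j + 1) hj.le)
      linarith
  rcases k with _ | k
  · simp
  · exact (mul_nonneg (hw0 ⟨k, hk⟩ (by simp)) (ht _ le_rfl)).trans (key k (by omega))

/-! ### Convex functions of the logarithm -/

/-- The right derivative, as a subgradient of a convex function on the line. -/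
lemma ConvexOn.add_rightDeriv_mul_le {φ : ℝ → ℝ} (hφ : ConvexOn ℝ Set.univ φ) (x y : ℝ) :
    φ x + derivWithin φ (Set.Ioi x) x * (y - x) ≤ φ y := by
  have hint : ∀ z : ℝ, z ∈ interior (Set.univ : Set ℝ) := by simp
  rcases lt_trichotomy x y with h | rfl | h
  · have := hφ.rightDeriv_le_slope_of_mem_interior (hint x) (Set.mem_univ y) h
    rw [slope_def_field, le_div_iff₀ (by linarith)] at this
    linarith
  · simp
  · have h1 := hφ.slope_le_leftDeriv_of_mem_interior (Set.mem_univ y) (hint x) h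
    have h2 := h1.trans (hφ.leftDeriv_le_rightDeriv_of_mem_interior (hint x))
    rw [slope_def_field, div_le_iff₀ (by linarith)] at h2
    linarith

/-- A negative subgradient anywhere would force `φ` to `+∞` at `-∞`. -/
lemma ConvexOn.monotone_of_tendsto_atBot {φ : ℝ → ℝ} (hφ : ConvexOn ℝ Set.univ φ) {l : ℝ}
    (hl : Filter.Tendsto φ Filter.atBot (nhds l)) : Monotone φ := by
  have hs : ∀ x, 0 ≤ derivWithin φ (Set.Ioi x) x := by
    intro x
    by_contra! hneg
    have h1 : ∀ᶠ z in Filter.atBot, φ z < l + 1 := hl.eventually (gt_mem_nhds (by linarith))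
    have h2 : Filter.Tendsto (fun z => φ x + derivWithin φ (Set.Ioi x) x * (z - x))
        Filter.atBot Filter.atTop := by
      apply Filter.tendsto_atTop_add_const_left
      apply Filter.Tendsto.const_mul_atBot_of_neg hneg
      exact Filter.tendsto_atBot_add_const_right _ _ Filter.tendsto_id
    obtain ⟨z, hz1, hz2⟩ := (h1.and (h2.eventually_ge_atTop (l + 1))).exists
    linarith [hφ.add_rightDeriv_mul_le x z]
  intro x y hxy
  have := hφ.add_rightDeriv_mul_le x y
  nlinarith [mul_nonneg (hs x) (sub_nonneg.2 hxy)]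

lemma Monotone.rightDeriv_nonneg {φ : ℝ → ℝ} (hm : Monotone φ) (x : ℝ) :
    0 ≤ derivWithin φ (Set.Ioi x) x :=
  (hm.monotoneOn _).derivWithin_nonneg

lemma tendsto_comp_exp_atBot {g : ℝ → ℝ} (hg : ContinuousOn g (Set.Ici 0)) :
    Filter.Tendsto (fun x => g (Real.exp x)) Filter.atBot (nhds (g 0)) :=
  (hg 0 (by simp)).tendsto.comp
    (tendsto_nhdsWithin_iff.2 ⟨Real.tendsto_exp_atBot, by simp [Real.exp_nonneg]⟩)

lemma monotone_comp_exp {g : ℝ → ℝ} (hg : ContinuousOn g (Set.Ici 0))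
    (hc : ConvexOn ℝ Set.univ fun x => g (Real.exp x)) : Monotone fun x => g (Real.exp x) :=
  hc.monotone_of_tendsto_atBot (tendsto_comp_exp_atBot hg)

/-- Continuity at `0` is what excludes decreasing functions such as `1 / x`: it gives `g ∘ exp` a
finite limit at `-∞`. -/
lemma monotoneOn_of_convexOn_comp_exp {g : ℝ → ℝ} (hg : ContinuousOn g (Set.Ici 0))
    (hc : ConvexOn ℝ Set.univ fun x => g (Real.exp x)) : MonotoneOn g (Set.Ici 0) := by
  have hm := monotone_comp_exp hg hc
  have pos : ∀ x y : ℝ, 0 < x → x ≤ y → g x ≤ g y := by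
    intro x y hx hxy
    have := hm (Real.log_le_log hx hxy)
    simpa [Real.exp_log hx, Real.exp_log (hx.trans_le hxy)] using this
  intro x hx y hy hxy
  rcases (show (0 : ℝ) ≤ x from hx).eq_or_lt with rfl | hx0
  · rcases hxy.eq_or_lt with rfl | hy0
    · rfl
    · refine le_of_tendsto (tendsto_comp_exp_atBot hg) ?_
      filter_upwards [Filter.eventually_le_atBot (Real.log y)] with z hz
      have := hm hz
      simpa [Real.exp_log hy0] using this
  · exact pos x y hx0 hxy

/-- Weak log-majorization implies weak majorization after applying a function that is convex in
the logarithm. -/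
lemma sum_le_sum_of_weakLogMajorized {r : ℕ} {a b : Fin r → ℝ} (ha : Antitone a)
    (ha0 : ∀ i, 0 ≤ a i) (hb0 : ∀ i, 0 ≤ b i)
    (hab : ∀ k ≤ r, ∏ i : Fin r with i.val < k, a i ≤ ∏ i : Fin r with i.val < k, b i)
    {g : ℝ → ℝ} (hg : ContinuousOn g (Set.Ici 0))
    (hc : ConvexOn ℝ Set.univ fun x => g (Real.exp x)) (k : ℕ) (hk : k ≤ r) :
    ∑ i : Fin r with i.val < k, g (a i) ≤ ∑ i : Fin r with i.val < k, g (b i) := by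
  induction k with
  | zero => simp
  | succ k ih =>
    -- If the last entry of `a` vanishes, monotonicity handles it alone. Otherwise all entries of
    -- `a`, and by the product inequality those of `b`, are positive and have real logarithms.
    rcases (ha0 ⟨k, hk⟩).eq_or_lt with h0 | hpos
    · rw [sum_val_lt_succ hk, sum_val_lt_succ hk, ← h0]
      exact add_le_add (ih (by omega))
        (monotoneOn_of_convexOn_comp_exp hg hc (by simp) (hb0 _) (hb0 _))
    · have hapos : ∀ i : Fin r, i.val < k + 1 → 0 < a i := fun i hi =>
        hpos.trans_le (ha (by simp [Fin.le_def]; omega))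
      have hprod : ∀ j ≤ k + 1, 0 < ∏ i : Fin r with i.val < j, a i := fun j hj =>
        Finset.prod_pos fun i hi => hapos i (by simp at hi; omega)
      have hbpos : ∀ i : Fin r, i.val < k + 1 → 0 < b i := by
        intro i hi
        refine (hb0 i).lt_of_ne fun h => ?_
        have h1 := (hprod _ le_rfl).trans_le (hab (k + 1) hk)
        rw [Finset.prod_eq_zero (i := i) (by simpa using hi) h.symm] at h1
        exact lt_irrefl _ h1
      set h : ℝ → ℝ := fun x => g (Real.exp x) with hh
      have hm : Monotone h := monotone_comp_exp hg hc
      -- The weights are subgradients of `h` at `log (a i)`: decreasing by convexity, nonnegative by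
      -- monotonicity. The subgradient inequality then compares `g (b i) - g (a i)` with weight
      -- times `t i`.
      have main := sum_mul_nonneg_of_partial_sums hk
        (w := fun i => derivWithin h (Set.Ioi (Real.log (a i))) (Real.log (a i)))
        (t := fun i => Real.log (b i) - Real.log (a i)) ?_ ?_ ?_
      · rw [← sub_nonneg, ← Finset.sum_sub_distrib]
        refine main.trans (Finset.sum_le_sum fun i hi => ?_)
        have hi' : i.val < k + 1 := by simpa using hi
        have := hc.add_rightDeriv_mul_le (Real.log (a i)) (Real.log (b i))
        rw [show h (Real.log (a i)) = g (a i) by simp [hh, Real.exp_log (hapos i hi')],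
          show h (Real.log (b i)) = g (b i) by simp [hh, Real.exp_log (hbpos i hi')]] at this
        linarith
      · intro i j hij hj
        exact hc.monotoneOn_rightDeriv (by simp) (by simp)
          (Real.log_le_log (hapos j hj) (ha hij))
      · intro i _
        exact hm.rightDeriv_nonneg _
      · intro j hj
        rw [Finset.sum_sub_distrib, sub_nonneg,
          ← Real.log_prod fun i hi => (hapos i (by simp at hi; omega)).ne',
          ← Real.log_prod fun i hi => (hbpos i (by simp at hi; omega)).ne']
        exact Real.log_le_log (hprod j hj) (hab j (hj.trans hk))

/-! ### Log-convex functions of the logarithm -/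

/-- Exponentiating removes the value `-∞`: it becomes a factor `0 ^ a = 0`. -/
lemma ConvexLogExp.le_rpow_mul_rpow {f : ℝ → ℝ} (hf : ConvexLogExp f) (hf0 : ∀ x, 0 ≤ x → 0 ≤ f x)
    {x y a b : ℝ} (ha : 0 < a) (hb : 0 < b) (hab : a + b = 1) :
    f (Real.exp (a * x + b * y)) ≤ f (Real.exp x) ^ a * f (Real.exp y) ^ b := by
  have h := EReal.exp_monotone (hf x y a b ha hb hab)
  have e := fun z => hf0 _ (Real.exp_nonneg z)
  rw [EReal.exp_add, mul_comm (a : EReal), mul_comm (b : EReal), EReal.exp_mul, EReal.exp_mul] at h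
  simp only [extLog, ENNReal.exp_log] at h
  rw [ENNReal.ofReal_rpow_of_nonneg (e x) ha.le, ENNReal.ofReal_rpow_of_nonneg (e y) hb.le,
    ← ENNReal.ofReal_mul (Real.rpow_nonneg (e x) a)] at h
  exact (ENNReal.ofReal_le_ofReal_iff
    (mul_nonneg (Real.rpow_nonneg (e x) a) (Real.rpow_nonneg (e y) b))).1 h

/-- By weighted AM–GM; hence the majorization argument for 3 also serves 2. -/
lemma ConvexLogExp.convexOn {f : ℝ → ℝ} (hf : ConvexLogExp f) (hf0 : ∀ x, 0 ≤ x → 0 ≤ f x) :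
    ConvexOn ℝ Set.univ fun x => f (Real.exp x) := by
  refine convexOn_iff_forall_pos.2 ⟨convex_univ, fun x _ y _ a b ha hb hab => ?_⟩
  exact (hf.le_rpow_mul_rpow hf0 ha hb hab).trans
    (Real.geom_mean_le_arith_mean2_weighted ha.le hb.le (hf0 _ (Real.exp_nonneg x))
      (hf0 _ (Real.exp_nonneg y)) hab)

/-- Since `x` is the midpoint of `y` and `2 * x - y`, a zero at `y` would force one at `x`. So `f ∘
exp` is positive everywhere or zero everywhere. -/
lemma ConvexLogExp.pos {f : ℝ → ℝ} (hf : ConvexLogExp f) (hf0 : ∀ x, 0 ≤ x → 0 ≤ f x) {x : ℝ}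
    (hx : 0 < f (Real.exp x)) (y : ℝ) : 0 < f (Real.exp y) := by
  refine (hf0 _ (Real.exp_nonneg y)).lt_of_ne fun h => ?_
  have := hf.le_rpow_mul_rpow hf0 (x := y) (y := 2 * x - y) (a := 1 / 2) (b := 1 / 2)
    (by norm_num) (by norm_num) (by norm_num)
  rw [← h, Real.zero_rpow (by norm_num), zero_mul,
    show 1 / 2 * y + 1 / 2 * (2 * x - y) = x by ring] at this
  linarith

lemma ConvexLogExp.convexOn_log {f : ℝ → ℝ} (hf : ConvexLogExp f) (hf0 : ∀ x, 0 ≤ x → 0 ≤ f x)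
    {x : ℝ} (hx : 0 < f (Real.exp x)) : ConvexOn ℝ Set.univ fun x => Real.log (f (Real.exp x)) := by
  refine convexOn_iff_forall_pos.2 ⟨convex_univ, fun y _ z _ a b ha hb hab => ?_⟩
  have hy := hf.pos hf0 hx y
  have hz := hf.pos hf0 hx z
  have h := Real.log_le_log (hf.pos hf0 hx _) (hf.le_rpow_mul_rpow hf0 (x := y) (y := z) ha hb hab)
  rwa [Real.log_mul (Real.rpow_pos_of_pos hy a).ne' (Real.rpow_pos_of_pos hz b).ne',
    Real.log_rpow hy, Real.log_rpow hz] at h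

lemma convexOn_log_add_exp {ε : ℝ} (hε : 0 < ε) :
    ConvexOn ℝ Set.univ fun x => Real.log (ε + Real.exp x) := by
  have hd : ∀ x, HasDerivAt (fun x => Real.log (ε + Real.exp x))
      (Real.exp x / (ε + Real.exp x)) x := fun x =>
    ((Real.hasDerivAt_exp x).const_add ε).log (by positivity)
  refine Monotone.convexOn_univ_of_deriv (fun x => (hd x).differentiableAt) ?_
  intro x y hxy
  rw [(hd x).deriv, (hd y).deriv, div_le_div_iff₀ (by positivity) (by positivity)]
  nlinarith [Real.exp_le_exp.2 hxy]

lemma convexOn_log_one_add_exp_div {ε : ℝ} (hε : 0 < ε) :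
    ConvexOn ℝ Set.univ fun x => Real.log (1 + Real.exp x / ε) := by
  refine ((convexOn_log_add_exp hε).add_const (-Real.log ε)).congr fun x _ => ?_
  have : 1 + Real.exp x / ε = (ε + Real.exp x) / ε := by field_simp
  rw [this, Real.log_div (by positivity) hε.ne']
  simp [sub_eq_add_neg]

lemma convexLogExp_add_rpow {ε p : ℝ} (hε : 0 < ε) (hp : 0 < p) :
    ConvexLogExp fun x => (ε + x) ^ p := by
  intro x y a b ha hb hab
  have e : ∀ z, extLog ((ε + Real.exp z) ^ p) = ((p * Real.log (ε + Real.exp z) : ℝ) : EReal) := by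
    intro z
    rw [extLog, ENNReal.log_ofReal_of_pos (by positivity), Real.log_rpow (by positivity)]
  have h := (convexOn_log_add_exp hε).2 (Set.mem_univ x) (Set.mem_univ y) ha.le hb.le hab
  simp only [smul_eq_mul] at h
  simp only [e]
  norm_cast
  nlinarith [mul_le_mul_of_nonneg_left h hp.le]

/-! ### The geometric mean of a nonnegative function -/

section GeomMean

variable {Ω : Type*} [MeasurableSpace Ω]

/-- The geometric mean `exp ∫ log v dν`. -/
noncomputable def geomMean (ν : Measure Ω) (v : Ω → ℝ) : ℝ≥0∞ :=
  EReal.exp (extIntegral ν fun τ => extLog (v τ))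

lemma extLog_mono {x y : ℝ} (h : x ≤ y) : extLog x ≤ extLog y :=
  ENNReal.log_monotone (ENNReal.ofReal_le_ofReal h)

lemma extLog_of_pos {x : ℝ} (h : 0 < x) : extLog x = (Real.log x : EReal) :=
  ENNReal.log_ofReal_of_pos h

lemma continuous_extLog : Continuous extLog :=
  ENNReal.continuous_log.comp ENNReal.continuous_ofReal

lemma toENNReal_extLog_le {x K : ℝ} (hK : 1 ≤ K) (h : x ≤ K) :
    (extLog x).toENNReal ≤ ENNReal.ofReal (Real.log K) := by
  rw [← EReal.real_coe_toENNReal, ← extLog_of_pos (by linarith)]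
  exact EReal.toENNReal_le_toENNReal (extLog_mono h)

variable (ν : Measure Ω)

/-- Positive and negative parts are compared separately, so no measurability is needed; this matters
for `τ ↦ ρ (cfc f (D τ))`. -/
lemma geomMean_mono_ae {u v : Ω → ℝ} (h : ∀ᵐ τ ∂ν, u τ ≤ v τ) : geomMean ν u ≤ geomMean ν v := by
  refine EReal.exp_monotone (EReal.sub_le_sub ?_ ?_)
  · exact EReal.coe_ennreal_le_coe_ennreal_iff.2 (lintegral_mono_ae (h.mono fun τ hτ =>
      EReal.toENNReal_le_toENNReal (extLog_mono hτ)))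
  · exact EReal.coe_ennreal_le_coe_ennreal_iff.2 (lintegral_mono_ae (h.mono fun τ hτ =>
      EReal.toENNReal_le_toENNReal (EReal.neg_le_neg_iff.2 (extLog_mono hτ))))

lemma geomMean_mono {u v : Ω → ℝ} (h : ∀ τ, u τ ≤ v τ) : geomMean ν u ≤ geomMean ν v :=
  geomMean_mono_ae ν (Filter.Eventually.of_forall h)

lemma geomMean_eq_of_integrable {v : Ω → ℝ} (hpos : ∀ᵐ τ ∂ν, 0 < v τ)
    (hint : Integrable (fun τ => Real.log (v τ)) ν) :
    geomMean ν v = ENNReal.ofReal (Real.exp (∫ τ, Real.log (v τ) ∂ν)) := by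
  have h1 : ∫⁻ τ, (extLog (v τ)).toENNReal ∂ν = ∫⁻ τ, ENNReal.ofReal (Real.log (v τ)) ∂ν :=
    lintegral_congr_ae (hpos.mono fun τ hτ => by
      simp only [extLog_of_pos hτ, EReal.real_coe_toENNReal])
  have h2 : ∫⁻ τ, (-extLog (v τ)).toENNReal ∂ν = ∫⁻ τ, ENNReal.ofReal (-Real.log (v τ)) ∂ν :=
    lintegral_congr_ae (hpos.mono fun τ hτ => by
      simp only [extLog_of_pos hτ, ← EReal.coe_neg, EReal.real_coe_toENNReal])
  have f1 : ∫⁻ τ, ENNReal.ofReal (Real.log (v τ)) ∂ν ≠ ∞ := hint.lintegral_lt_top.ne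
  have f2 : ∫⁻ τ, ENNReal.ofReal (-Real.log (v τ)) ∂ν ≠ ∞ := hint.neg.lintegral_lt_top.ne
  have hc : ∀ x : ℝ≥0∞, x ≠ ∞ → ((x.toReal : ℝ) : EReal) = (x : EReal) := fun x hx => by
    lift x to NNReal using hx
    rfl
  rw [geomMean, extIntegral, h1, h2, ← EReal.exp_coe,
    integral_eq_lintegral_pos_part_sub_lintegral_neg_part hint, EReal.coe_sub,
    hc _ f1, hc _ f2]

variable [IsProbabilityMeasure ν]

lemma lintegral_toENNReal_extLog_ne_top {v : Ω → ℝ} {K : ℝ} (hK : ∀ τ, v τ ≤ K) :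
    ∫⁻ τ, (extLog (v τ)).toENNReal ∂ν ≠ ∞ := by
  have : ∫⁻ τ, (extLog (v τ)).toENNReal ∂ν ≤ ∫⁻ _, ENNReal.ofReal (Real.log (max K 1)) ∂ν :=
    lintegral_mono fun τ => toENNReal_extLog_le (le_max_right _ _) ((hK τ).trans (le_max_left _ _))
  exact ne_top_of_le_ne_top (by simp) this

lemma geomMean_ne_top {v : Ω → ℝ} {K : ℝ} (hK : ∀ τ, v τ ≤ K) : geomMean ν v ≠ ∞ := by
  rw [geomMean, Ne, EReal.exp_eq_top_iff]
  have h := lintegral_toENNReal_extLog_ne_top ν hK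
  refine (lt_of_le_of_lt (b := ((∫⁻ τ, (extLog (v τ)).toENNReal ∂ν : ℝ≥0∞) : EReal) - 0)
    (EReal.sub_le_sub le_rfl (EReal.coe_ennreal_nonneg _)) ?_).ne
  rw [sub_zero, lt_top_iff_ne_top]
  exact EReal.coe_ennreal_eq_top_iff.not.2 h

/-- A bounded function with nonzero geometric mean has an integrable logarithm. -/
lemma pos_and_integrable_of_geomMean_ne_zero {v : Ω → ℝ} (hv : Measurable v) {K : ℝ}
    (hK : ∀ τ, v τ ≤ K) (h : geomMean ν v ≠ 0) :
    (∀ᵐ τ ∂ν, 0 < v τ) ∧ Integrable (fun τ => Real.log (v τ)) ν := by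
  have hP := lintegral_toENNReal_extLog_ne_top ν hK
  -- In `EReal`, subtracting `⊤` always gives `⊥`, so an infinite negative part makes the geometric
  -- mean zero.
  have hN : ∫⁻ τ, (-extLog (v τ)).toENNReal ∂ν ≠ ∞ := by
    intro hN
    apply h
    rw [geomMean, extIntegral, hN]
    simp
  have hmeas : Measurable fun τ => (-extLog (v τ)).toENNReal :=
    (EReal.continuous_toENNReal.comp (continuous_neg.comp continuous_extLog)).measurable.comp
      hv
  have hpos : ∀ᵐ τ ∂ν, 0 < v τ := by
    filter_upwards [ae_lt_top hmeas hN] with τ hτ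
    by_contra! hle
    simp [extLog, ENNReal.ofReal_of_nonpos hle] at hτ
  refine ⟨hpos, (Real.measurable_log.comp hv).aestronglyMeasurable, ?_⟩
  have hle : ∫⁻ τ, ‖Real.log (v τ)‖ₑ ∂ν ≤
      ∫⁻ τ, ((extLog (v τ)).toENNReal + (-extLog (v τ)).toENNReal) ∂ν := by
    refine lintegral_mono_ae (hpos.mono fun τ hτ => ?_)
    rw [extLog_of_pos hτ, ← EReal.coe_neg, EReal.real_coe_toENNReal,
      EReal.real_coe_toENNReal, ← ofReal_norm, Real.norm_eq_abs]
    rcases abs_cases (Real.log (v τ)) with ⟨h, _⟩ | ⟨h, _⟩ <;> rw [h]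
    · exact le_self_add
    · exact le_add_self
  rw [lintegral_add_right _ hmeas] at hle
  exact hle.trans_lt (ENNReal.add_lt_top.2 ⟨hP.lt_top, hN.lt_top⟩)

lemma integrable_log_of_le_of_le {v : Ω → ℝ} (hv : Measurable v) {ε K : ℝ} (hε : 0 < ε)
    (h : ∀ τ, ε ≤ v τ) (hK : ∀ τ, v τ ≤ K) : Integrable (fun τ => Real.log (v τ)) ν := by
  refine .of_bound (Real.measurable_log.comp hv).aestronglyMeasurable
    (max |Real.log ε| |Real.log K|) (Filter.Eventually.of_forall fun τ => ?_)
  exact abs_le_max_abs_abs (Real.log_le_log hε (h τ))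
    (Real.log_le_log (hε.trans_le (h τ)) (hK τ))

lemma geomMean_const {c : ℝ} (hc : 0 ≤ c) : geomMean ν (fun _ => c) = ENNReal.ofReal c := by
  rcases hc.eq_or_lt with rfl | hc
  · simp [geomMean, extIntegral, extLog]
  · rw [geomMean_eq_of_integrable ν (by simp [hc]) (by simp)]
    simp [Real.exp_log hc]

lemma mul_geomMean_le {v : Ω → ℝ} (hv : Measurable v) {K : ℝ} (hK : ∀ τ, v τ ≤ K) {c : ℝ}
    (hc : 0 ≤ c) : ENNReal.ofReal c * geomMean ν v ≤ geomMean ν fun τ => c * v τ := by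
  rcases hc.eq_or_lt with rfl | hc
  · simp
  by_cases h : geomMean ν v = 0
  · simp [h]
  obtain ⟨hpos, hint⟩ := pos_and_integrable_of_geomMean_ne_zero ν hv hK h
  have hlog : (fun τ => Real.log (c * v τ)) =ᵐ[ν] fun τ => Real.log c + Real.log (v τ) :=
    hpos.mono fun τ hτ => Real.log_mul hc.ne' hτ.ne'
  rw [geomMean_eq_of_integrable ν hpos hint, geomMean_eq_of_integrable ν
    (hpos.mono fun τ hτ => mul_pos hc hτ) (((integrable_const _).add hint).congr hlog.symm),
    integral_congr_ae hlog, integral_add (integrable_const _) hint, Real.exp_add,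
    ENNReal.ofReal_mul (Real.exp_nonneg _)]
  simp [Real.exp_log hc]

/-- The inequality between the geometric and the arithmetic mean. -/
lemma exp_integral_log_le_integral {v : Ω → ℝ} (hpos : ∀ᵐ τ ∂ν, 0 < v τ)
    (hlog : Integrable (fun τ => Real.log (v τ)) ν) (hint : Integrable v ν) :
    Real.exp (∫ τ, Real.log (v τ) ∂ν) ≤ ∫ τ, v τ ∂ν := by
  have he : (fun τ => Real.exp (Real.log (v τ))) =ᵐ[ν] v := hpos.mono fun τ hτ => Real.exp_log hτ
  rw [← integral_congr_ae he]
  exact convexOn_exp.map_integral_le Real.continuous_exp.continuousOn isClosed_univ (by simp) hlog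
    (hint.congr he.symm)

/-- AM–GM applied to `u / (u + v)` and `v / (u + v)` bounds the quotients of geometric means by two
integrals that add up to `1`. -/
lemma geomMean_add_le {u v : Ω → ℝ} (hu : Measurable u) (hv : Measurable v) {K : ℝ}
    (hu0 : ∀ τ, 0 ≤ u τ) (hv0 : ∀ τ, 0 ≤ v τ) (huK : ∀ τ, u τ ≤ K) (hvK : ∀ τ, v τ ≤ K) :
    geomMean ν u + geomMean ν v ≤ geomMean ν fun τ => u τ + v τ := by
  by_cases h1 : geomMean ν u = 0
  · rw [h1, zero_add]
    exact geomMean_mono ν fun τ => by linarith [hu0 τ]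
  by_cases h2 : geomMean ν v = 0
  · rw [h2, add_zero]
    exact geomMean_mono ν fun τ => by linarith [hv0 τ]
  have h3 : geomMean ν (fun τ => u τ + v τ) ≠ 0 := fun h => h1 (le_zero_iff.1
    ((geomMean_mono ν fun τ => by linarith [hv0 τ]).trans_eq h))
  obtain ⟨pu, iu⟩ := pos_and_integrable_of_geomMean_ne_zero ν hu huK h1
  obtain ⟨pv, iv⟩ := pos_and_integrable_of_geomMean_ne_zero ν hv hvK h2
  obtain ⟨ps, is⟩ := pos_and_integrable_of_geomMean_ne_zero ν (hu.add hv) (K := K + K)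
    (fun τ => add_le_add (huK τ) (hvK τ)) h3
  simp only [Pi.add_apply] at ps is
  rw [geomMean_eq_of_integrable ν pu iu, geomMean_eq_of_integrable ν pv iv,
    geomMean_eq_of_integrable ν ps is, ← ENNReal.ofReal_add (Real.exp_nonneg _) (Real.exp_nonneg _)]
  apply ENNReal.ofReal_le_ofReal
  have ratio : ∀ w : Ω → ℝ, Measurable w → (∀ τ, 0 ≤ w τ) → (∀ τ, w τ ≤ u τ + v τ) →
      (∀ᵐ τ ∂ν, 0 < w τ) → Integrable (fun τ => Real.log (w τ)) ν →
      Integrable (fun τ => w τ / (u τ + v τ)) ν ∧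
      Real.exp (∫ τ, Real.log (w τ) ∂ν) ≤
        Real.exp (∫ τ, Real.log (u τ + v τ) ∂ν) * ∫ τ, w τ / (u τ + v τ) ∂ν := by
    intro w hw hw0 hle pw iw
    have hi : Integrable (fun τ => w τ / (u τ + v τ)) ν := by
      refine .of_bound (hw.div (hu.add hv)).aestronglyMeasurable 1
        (Filter.Eventually.of_forall fun τ => ?_)
      rw [Real.norm_eq_abs, abs_of_nonneg (div_nonneg (hw0 τ) (add_nonneg (hu0 τ) (hv0 τ)))]
      exact div_le_one_of_le₀ (hle τ) (add_nonneg (hu0 τ) (hv0 τ))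
    have hl : (fun τ => Real.log (w τ / (u τ + v τ))) =ᵐ[ν]
        fun τ => Real.log (w τ) - Real.log (u τ + v τ) := by
      filter_upwards [pw, ps] with τ h h'
      exact Real.log_div h.ne' h'.ne'
    have := exp_integral_log_le_integral ν
      (by filter_upwards [pw, ps] with τ h h' using div_pos h h') ((iw.sub is).congr hl.symm) hi
    rw [integral_congr_ae hl, integral_sub iw is, Real.exp_sub,
      div_le_iff₀ (Real.exp_pos _)] at this
    exact ⟨hi, by linarith⟩
  obtain ⟨iu', hu'⟩ := ratio u hu hu0 (fun τ => by linarith [hv0 τ]) pu iu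
  obtain ⟨iv', hv'⟩ := ratio v hv hv0 (fun τ => by linarith [hu0 τ]) pv iv
  have hone : (∫ τ, u τ / (u τ + v τ) ∂ν) + ∫ τ, v τ / (u τ + v τ) ∂ν = 1 := by
    rw [← integral_add iu' iv', integral_congr_ae (g := fun _ => (1 : ℝ))]
    · simp
    · filter_upwards [ps] with τ h
      rw [← add_div, div_self h.ne']
  calc _ ≤ _ := add_le_add hu' hv'
    _ = _ := by rw [← mul_add, hone, mul_one]

/-- The geometric mean is a superadditive function. -/
lemma sum_mul_geomMean_le {ι : Type*} (s : Finset ι) {w : ι → ℝ} {v : ι → Ω → ℝ}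
    (hw : ∀ i, 0 ≤ w i) (hv : ∀ i, Measurable (v i)) (hv0 : ∀ i τ, 0 ≤ v i τ) {K : ℝ}
    (hK : ∀ i τ, v i τ ≤ K) :
    ∑ i ∈ s, ENNReal.ofReal (w i) * geomMean ν (v i) ≤ geomMean ν fun τ => ∑ i ∈ s, w i * v i τ := by
  classical
  induction s using Finset.induction_on with
  | empty => simp
  | insert i s hi ih =>
    simp only [Finset.sum_insert hi]
    refine (add_le_add (mul_geomMean_le ν (hv i) (hK i) (hw i)) ih).trans ?_
    refine geomMean_add_le ν ((hv i).const_mul _)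
      (Finset.measurable_sum s fun j _ => (hv j).const_mul _)
      (K := max (w i * K) (∑ j ∈ s, w j * K)) (fun τ => mul_nonneg (hw i) (hv0 i τ))
      (fun τ => Finset.sum_nonneg fun j _ => mul_nonneg (hw j) (hv0 j τ))
      (fun τ => le_max_of_le_left (mul_le_mul_of_nonneg_left (hK i τ) (hw i)))
      (fun τ => le_max_of_le_right (Finset.sum_le_sum fun j _ =>
        mul_le_mul_of_nonneg_left (hK j τ) (hw j)))

lemma measurable_comp_of_continuousOn_Ici {g : ℝ → ℝ} (hg : ContinuousOn g (Set.Ici 0)) {v : Ω → ℝ}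
    (hv : Measurable v) (hv0 : ∀ τ, 0 ≤ v τ) : Measurable fun τ => g (v τ) := by
  have hcont : Continuous fun x => g (max x 0) :=
    hg.comp_continuous (continuous_id.max continuous_const) fun x => by simp
  have he : (fun τ => g (v τ)) = (fun x => g (max x 0)) ∘ v := by
    funext τ
    simp [max_eq_left (hv0 τ)]
  rw [he]
  exact hcont.measurable.comp hv

/-- Jensen's inequality for functions that are convex in the logarithm. -/
lemma apply_geomMean_le_lintegral {g : ℝ → ℝ} (hg : ContinuousOn g (Set.Ici 0))
    (hg0 : ∀ x, 0 ≤ x → 0 ≤ g x) (hc : ConvexOn ℝ Set.univ fun x => g (Real.exp x)) {v : Ω → ℝ}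
    (hv : Measurable v) (hv0 : ∀ τ, 0 ≤ v τ) {K : ℝ} (hK : ∀ τ, v τ ≤ K) :
    ENNReal.ofReal (g (geomMean ν v).toReal) ≤ ∫⁻ τ, ENNReal.ofReal (g (v τ)) ∂ν := by
  have hm := monotoneOn_of_convexOn_comp_exp hg hc
  by_cases h : geomMean ν v = 0
  · rw [h, ENNReal.toReal_zero]
    calc ENNReal.ofReal (g 0) = ∫⁻ _, ENNReal.ofReal (g 0) ∂ν := by simp
      _ ≤ _ := lintegral_mono fun τ => ENNReal.ofReal_le_ofReal (hm (by simp) (hv0 τ) (hv0 τ))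
  obtain ⟨hpos, hlog⟩ := pos_and_integrable_of_geomMean_ne_zero ν hv hK h
  have he : (fun τ => g (Real.exp (Real.log (v τ)))) =ᵐ[ν] fun τ => g (v τ) :=
    hpos.mono fun τ hτ => by simp only [Real.exp_log hτ]
  have hgm := measurable_comp_of_continuousOn_Ici hg hv hv0
  have hint : Integrable (fun τ => g (v τ)) ν := by
    refine .of_bound hgm.aestronglyMeasurable (g K) (Filter.Eventually.of_forall fun τ => ?_)
    rw [Real.norm_eq_abs, abs_of_nonneg (hg0 _ (hv0 τ))]
    exact hm (hv0 τ) ((hv0 τ).trans (hK τ)) (hK τ)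
  rw [geomMean_eq_of_integrable ν hpos hlog, ENNReal.toReal_ofReal (Real.exp_nonneg _),
    ← ofReal_integral_eq_lintegral_ofReal hint
      (Filter.Eventually.of_forall fun τ => hg0 _ (hv0 τ)), ← integral_congr_ae he]
  apply ENNReal.ofReal_le_ofReal
  refine hc.map_integral_le ?_ isClosed_univ (by simp) hlog (hint.congr he.symm)
  exact (hg.comp_continuous Real.continuous_exp fun x => Real.exp_nonneg x).continuousOn

/-- The supporting line of `log (f (exp x))` at the mean `m` of `log v` has integral equal to its
value at `m`. Comparing with this line, through `geomMean_mono_ae`, avoids proving `log (f (v τ))`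
integrable. -/
lemma apply_geomMean_le_geomMean {f : ℝ → ℝ} (hf : ContinuousOn f (Set.Ici 0))
    (hf0 : ∀ x, 0 ≤ x → 0 ≤ f x) (hc : ConvexLogExp f) {v : Ω → ℝ}
    (hv : Measurable v) (hv0 : ∀ τ, 0 ≤ v τ) {K : ℝ} (hK : ∀ τ, v τ ≤ K) :
    ENNReal.ofReal (f (geomMean ν v).toReal) ≤ geomMean ν fun τ => f (v τ) := by
  have hm := monotoneOn_of_convexOn_comp_exp hf (hc.convexOn hf0)
  by_cases h : geomMean ν v = 0
  · rw [h, ENNReal.toReal_zero, ← geomMean_const ν (hf0 0 le_rfl)]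
    exact geomMean_mono ν fun τ => hm (by simp) (hv0 τ) (hv0 τ)
  obtain ⟨hpos, hlog⟩ := pos_and_integrable_of_geomMean_ne_zero ν hv hK h
  rw [geomMean_eq_of_integrable ν hpos hlog, ENNReal.toReal_ofReal (Real.exp_nonneg _)]
  set m := ∫ τ, Real.log (v τ) ∂ν with hmdef
  rcases (hf0 _ (Real.exp_nonneg m)).eq_or_lt with hz | hz
  · simp [← hz]
  set φ : ℝ → ℝ := fun x => Real.log (f (Real.exp x)) with hφ
  have hφc : ConvexOn ℝ Set.univ φ := hc.convexOn_log hf0 hz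
  set s := derivWithin φ (Set.Ioi m) m
  have hint : Integrable (fun τ => φ m + s * (Real.log (v τ) - m)) ν :=
    (integrable_const _).add ((hlog.sub (integrable_const _)).const_mul _)
  have hval : ∫ τ, (φ m + s * (Real.log (v τ) - m)) ∂ν = φ m := by
    have h1 : Integrable (fun τ => Real.log (v τ) - m) ν := hlog.sub (integrable_const _)
    rw [integral_add (integrable_const _) (h1.const_mul _), integral_const_mul,
      integral_sub hlog (integrable_const _)]
    simp [← hmdef]
  have heq := geomMean_eq_of_integrable ν (v := fun τ => Real.exp (φ m + s * (Real.log (v τ) - m)))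
    (by simp [Real.exp_pos]) (by simpa using hint)
  simp only [Real.log_exp] at heq
  rw [hval, hφ, Real.exp_log hz] at heq
  rw [← heq]
  refine geomMean_mono_ae ν (hpos.mono fun τ hτ => ?_)
  have h1 := hφc.add_rightDeriv_mul_le m (Real.log (v τ))
  have h2 : 0 < f (v τ) := by simpa [Real.exp_log hτ] using hc.pos hf0 hz (Real.log (v τ))
  have h3 : φ (Real.log (v τ)) = Real.log (f (v τ)) := by simp [hφ, Real.exp_log hτ]
  rw [h3] at h1
  exact (Real.le_log_iff_exp_le h2).1 h1

/-- Positive parts converge by domination, negative parts by monotone convergence, possibly to `∞`.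
The difference is continuous there because the positive limit is finite. -/
lemma tendsto_geomMean_add {v : Ω → ℝ} (hv : Measurable v) {K : ℝ} (hK : ∀ τ, v τ ≤ K) :
    Filter.Tendsto (fun n : ℕ => geomMean ν fun τ => v τ + 1 / ((n : ℝ) + 1)) Filter.atTop
      (nhds (geomMean ν v)) := by
  have hε : ∀ τ, Filter.Tendsto (fun n : ℕ => v τ + 1 / ((n : ℝ) + 1)) Filter.atTop
      (nhds (v τ)) := fun τ => by
    simpa using (tendsto_const_nhds (x := v τ)).add tendsto_one_div_add_atTop_nhds_zero_nat
  have cP : Continuous fun x => (extLog x).toENNReal :=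
    EReal.continuous_toENNReal.comp continuous_extLog
  have cN : Continuous fun x => (-extLog x).toENNReal :=
    EReal.continuous_toENNReal.comp (continuous_neg.comp continuous_extLog)
  have hP : Filter.Tendsto
      (fun n : ℕ => ∫⁻ τ, (extLog (v τ + 1 / ((n : ℝ) + 1))).toENNReal ∂ν) Filter.atTop
      (nhds (∫⁻ τ, (extLog (v τ)).toENNReal ∂ν)) := by
    refine tendsto_lintegral_of_dominated_convergence
      (fun _ => ENNReal.ofReal (Real.log (max (K + 1) 1)))
      (fun n => cP.measurable.comp (hv.add_const _)) (fun n => ?_) (by simp)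
      (Filter.Eventually.of_forall fun τ => (cP.tendsto _).comp (hε τ))
    refine Filter.Eventually.of_forall fun τ => toENNReal_extLog_le (le_max_right _ _) ?_
    refine le_max_of_le_left (add_le_add (hK τ) ?_)
    rw [div_le_one (by positivity)]
    linarith [Nat.cast_nonneg (α := ℝ) n]
  have hN : Filter.Tendsto
      (fun n : ℕ => ∫⁻ τ, (-extLog (v τ + 1 / ((n : ℝ) + 1))).toENNReal ∂ν) Filter.atTop
      (nhds (∫⁻ τ, (-extLog (v τ)).toENNReal ∂ν)) := by
    refine lintegral_tendsto_of_tendsto_of_monotone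
      (fun n => (cN.measurable.comp (hv.add_const _)).aemeasurable)
      (Filter.Eventually.of_forall fun τ n m hnm => ?_)
      (Filter.Eventually.of_forall fun τ => (cN.tendsto _).comp (hε τ))
    refine EReal.toENNReal_le_toENNReal (EReal.neg_le_neg_iff.2 (extLog_mono ?_))
    gcongr
  refine (ENNReal.continuous_exp.tendsto _).comp ?_
  have hP' := lintegral_toENNReal_extLog_ne_top ν hK
  have c1 := (continuous_coe_ennreal_ereal.tendsto _).comp hP
  have c2 := (continuous_neg.tendsto _).comp ((continuous_coe_ennreal_ereal.tendsto _).comp hN)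
  have := (EReal.continuousAt_add (p := (((∫⁻ τ, (extLog (v τ)).toENNReal ∂ν : ℝ≥0∞) : EReal),
    -((∫⁻ τ, (-extLog (v τ)).toENNReal ∂ν : ℝ≥0∞) : EReal))) (Or.inl (by simpa using hP'))
    (Or.inl (by simp))).tendsto.comp (c1.prodMk_nhds c2)
  exact this

end GeomMean

/-! ### Unitary matrices -/

section Unitary

variable {n : Type*} [Fintype n] [DecidableEq n]

lemma sum_row_normSq_of_unitary {U : Matrix n n ℂ} (hU : U ∈ unitaryGroup n ℂ) (i : n) :
    ∑ j, ‖U i j‖ ^ 2 = 1 := by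
  have h := congrFun (congrFun (mem_unitaryGroup_iff.1 hU) i) i
  simp only [mul_apply, star_apply, one_apply_eq] at h
  have h2 := congrArg Complex.re h
  simp only [Complex.re_sum, Complex.one_re] at h2
  rw [← h2]
  refine Finset.sum_congr rfl fun j _ => ?_
  rw [RCLike.star_def, Complex.mul_conj, Complex.ofReal_re, Complex.normSq_eq_norm_sq]

lemma sum_col_normSq_of_unitary {U : Matrix n n ℂ} (hU : U ∈ unitaryGroup n ℂ) (j : n) :
    ∑ i, ‖U i j‖ ^ 2 = 1 := by
  have h := sum_row_normSq_of_unitary (Unitary.star_mem hU) j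
  simpa only [star_apply, norm_star] using h

lemma permMatrix_mem_unitaryGroup (π : Equiv.Perm n) : π.permMatrix ℂ ∈ unitaryGroup n ℂ := by
  rw [mem_unitaryGroup_iff, star_eq_conjTranspose, conjTranspose_permMatrix, ← permMatrix_mul,
    inv_mul_cancel, permMatrix_one]

lemma diagonal_mem_unitaryGroup {s : n → ℂ} (hs : ∀ i, s i * star (s i) = 1) :
    diagonal s ∈ unitaryGroup n ℂ := by
  rw [mem_unitaryGroup_iff, star_eq_conjTranspose, diagonal_conjTranspose, diagonal_mul_diagonal,
    ← diagonal_one]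
  congr 1
  funext i
  exact hs i

lemma trace_diagonal_mul_mul_diagonal_mul (x d : n → ℂ) (U W : Matrix n n ℂ) :
    (diagonal x * U * diagonal d * W).trace = ∑ i, x i * ∑ j, U i j * d j * W j i := by
  simp only [trace, diag_apply, mul_apply (N := W), mul_diagonal, diagonal_mul, Finset.mul_sum]
  exact Finset.sum_congr rfl fun i _ => Finset.sum_congr rfl fun j _ => by ring

end Unitary

/-- Continuity of seminorms on finite-dimensional complex spaces. -/
lemma Seminorm.continuous_of_finiteDimensional_complex {E : Type*} [NormedAddCommGroup E]
    [NormedSpace ℂ E] [FiniteDimensional ℂ E] (p : Seminorm ℂ E) : Continuous p := by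
  have : FiniteDimensional ℝ E := FiniteDimensional.complexToReal E
  exact p.convexOn.locallyLipschitz.continuous

/-- A linear functional with coefficients in `[0, 1]` of sum at most `k` is bounded by the sum of
the `k` largest entries. -/
lemma sum_mul_le_sum_val_lt {r k : ℕ} (hk : k + 1 ≤ r) {x c : Fin r → ℝ} (hx : Antitone x)
    (hx0 : ∀ i, 0 ≤ x i) (hc0 : ∀ i, 0 ≤ c i) (hc1 : ∀ i, c i ≤ 1) (hc : ∑ i, c i ≤ (k + 1 : ℕ)) :
    ∑ i, x i * c i ≤ ∑ i : Fin r with i.val < k + 1, x i := by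
  -- With the threshold `m`, each product of `x i - m` and `c i` minus the indicator of the first `k
  -- + 1` indices is nonpositive.
  set m := x ⟨k, hk⟩
  have h1 : ∀ i : Fin r, (x i - m) * (c i - if i.val < k + 1 then 1 else 0) ≤ 0 := by
    intro i
    split_ifs with hi
    · exact mul_nonpos_of_nonneg_of_nonpos
        (sub_nonneg.2 (hx (by simp [Fin.le_def]; omega))) (by linarith [hc1 i])
    · exact mul_nonpos_of_nonpos_of_nonneg
        (sub_nonpos.2 (hx (by simp [Fin.le_def]; omega))) (by linarith [hc0 i])
  have h2 := Finset.sum_nonpos fun i (_ : i ∈ Finset.univ) => h1 i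
  have h3 : ∑ i : Fin r, (if i.val < k + 1 then (1 : ℝ) else 0) = (k + 1 : ℕ) := by
    rw [← Finset.sum_filter, Finset.sum_const, card_val_lt hk, nsmul_eq_mul, mul_one]
  have h4 : ∑ i : Fin r, x i * (if i.val < k + 1 then (1 : ℝ) else 0) =
      ∑ i : Fin r with i.val < k + 1, x i := by
    rw [Finset.sum_filter]
    exact Finset.sum_congr rfl fun i _ => by split_ifs <;> simp
  have h5 : ∑ i : Fin r, (x i - m) * (c i - if i.val < k + 1 then 1 else 0) =
      ∑ i, x i * c i - ∑ i : Fin r, x i * (if i.val < k + 1 then (1 : ℝ) else 0) -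
        m * (∑ i, c i - ∑ i : Fin r, (if i.val < k + 1 then (1 : ℝ) else 0)) := by
    simp only [Finset.mul_sum, ← Finset.sum_sub_distrib]
    exact Finset.sum_congr rfl fun i _ => by ring
  rw [h5, h3, h4] at h2
  nlinarith [mul_nonneg (hx0 ⟨k, hk⟩) (sub_nonneg.2 hc)]

/-! ### Diagonal tensors and spectral decomposition -/

section Tensor

variable {N : ℕ} {I : Fin N → ℕ}

/-- The enumeration of the multi-indices used for the eigenvalues. -/
noncomputable def multiIndexEquiv (I : Fin N → ℕ) :
    Fin (tensorDim I) ≃ ((j : Fin N) → Fin (I j)) :=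
  Fintype.equivOfCardEq (Fintype.card_fin _)

/-- The diagonal tensor with given real diagonal. -/
noncomputable def diagTensor (x : Fin (tensorDim I) → ℝ) : SquareTensor I :=
  diagonal fun i => (x ((multiIndexEquiv I).symm i) : ℂ)

lemma eigenvalueVector_antitone {H : SquareTensor I} (hH : H.PosSemidef) :
    Antitone (eigenvalueVector hH) :=
  hH.isHermitian.eigenvalues₀_antitone

lemma eigenvalueVector_nonneg {H : SquareTensor I} (hH : H.PosSemidef) (i : Fin (tensorDim I)) :
    0 ≤ eigenvalueVector hH i := by
  have := hH.eigenvalues_nonneg (multiIndexEquiv I i)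
  simpa [IsHermitian.eigenvalues, multiIndexEquiv, eigenvalueVector] using this

lemma cfc_eq_unitary_conj {H : SquareTensor I} (hH : H.PosSemidef) (f : ℝ → ℝ) :
    cfc f H = (hH.isHermitian.eigenvectorUnitary : SquareTensor I) *
      diagTensor (fun i => f (eigenvalueVector hH i)) *
      star (hH.isHermitian.eigenvectorUnitary : SquareTensor I) := by
  rw [hH.isHermitian.cfc_eq, IsHermitian.cfc, Unitary.conjStarAlgAut_apply]
  -- `multiIndexEquiv` is the enumeration inside `IsHermitian.eigenvalues`, so the diagonals agree
  -- by definition.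
  rfl

lemma eq_unitary_conj {H : SquareTensor I} (hH : H.PosSemidef) :
    H = (hH.isHermitian.eigenvectorUnitary : SquareTensor I) * diagTensor (eigenvalueVector hH) *
      star (hH.isHermitian.eigenvectorUnitary : SquareTensor I) := by
  conv_lhs => rw [hH.isHermitian.spectral_theorem, Unitary.conjStarAlgAut_apply]
  rfl

/-- The squared Frobenius norm is the sum of the squared eigenvalues. -/
lemma eigenvalueVector_le_frobeniusNorm {H : SquareTensor I} (hH : H.PosSemidef)
    (i : Fin (tensorDim I)) : eigenvalueVector hH i ≤ frobeniusNorm H := by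
  have htr : (Hᴴ * H).trace.re = ∑ j, eigenvalueVector hH j ^ 2 := by
    have hU := hH.isHermitian.eigenvectorUnitary.2
    have hH' : Hᴴ = H := hH.isHermitian
    rw [hH']
    nth_rw 1 2 [eq_unitary_conj hH]
    generalize (hH.isHermitian.eigenvectorUnitary : SquareTensor I) = U at hU ⊢
    have h1 : star U * U = 1 := mem_unitaryGroup_iff'.1 hU
    have h2 : U * diagTensor (eigenvalueVector hH) * star U *
        (U * diagTensor (eigenvalueVector hH) * star U) =
        U * (diagTensor (eigenvalueVector hH) * diagTensor (eigenvalueVector hH) * star U) := by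
      simp only [Matrix.mul_assoc]
      rw [← Matrix.mul_assoc (star U) U, h1, Matrix.one_mul]
    rw [h2, trace_mul_comm, Matrix.mul_assoc, h1, Matrix.mul_one, diagTensor, diagonal_mul_diagonal,
      trace_diagonal, Complex.re_sum, ← (multiIndexEquiv I).sum_comp]
    refine Finset.sum_congr rfl fun j _ => ?_
    rw [Equiv.symm_apply_apply, ← Complex.ofReal_mul, Complex.ofReal_re, sq]
  rw [frobeniusNorm, htr]
  exact Real.le_sqrt_of_sq_le (Finset.single_le_sum (f := fun j => eigenvalueVector hH j ^ 2)
    (fun j _ => sq_nonneg _) (Finset.mem_univ i))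

/-! ### Unitarily invariant norms -/

namespace IsUnitarilyInvariantNorm

variable {ρ : Seminorm ℂ (SquareTensor I)} (hρ : IsUnitarilyInvariantNorm ρ)
include hρ

lemma map_cfc {H : SquareTensor I} (hH : H.PosSemidef) (f : ℝ → ℝ) :
    ρ (cfc f H) = ρ (diagTensor fun i => f (eigenvalueVector hH i)) := by
  have hU := hH.isHermitian.eigenvectorUnitary.2
  rw [cfc_eq_unitary_conj hH, hρ.map_mul_unitary _ _ (Unitary.star_mem hU),
    hρ.map_unitary_mul _ _ hU]

/-- Permutation matrices are unitary; with the sign changes below, this makes `ρ ∘ diagTensor` a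
symmetric gauge. -/
lemma map_diagTensor_perm (π : Equiv.Perm (Fin (tensorDim I))) (x : Fin (tensorDim I) → ℝ) :
    ρ (diagTensor fun i => x (π i)) = ρ (diagTensor x) := by
  set σ : Equiv.Perm ((j : Fin N) → Fin (I j)) :=
    ((multiIndexEquiv I).symm.trans π).trans (multiIndexEquiv I) with hσ
  have h : diagTensor (fun i => x (π i)) =
      σ.permMatrix ℂ * diagTensor x * (σ⁻¹).permMatrix ℂ := by
    rw [Equiv.Perm.permMatrix, Equiv.Perm.permMatrix, PEquiv.toMatrix_toPEquiv_mul,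
      PEquiv.mul_toMatrix_toPEquiv, submatrix_submatrix]
    ext i j
    simp only [diagTensor, submatrix_apply, diagonal_apply, Function.comp_apply, id_eq]
    have hinv : (Equiv.symm σ⁻¹) j = σ j := rfl
    rw [hinv]
    by_cases hij : i = j
    · subst hij
      simp [hσ]
    · rw [if_neg hij, if_neg fun h => hij (σ.injective h)]
  rw [h, hρ.map_mul_unitary _ _ (permMatrix_mem_unitaryGroup _),
    hρ.map_unitary_mul _ _ (permMatrix_mem_unitaryGroup _)]

lemma map_diagTensor_sign {s : Fin (tensorDim I) → ℝ} (hs : ∀ i, s i * s i = 1)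
    (x : Fin (tensorDim I) → ℝ) : ρ (diagTensor fun i => s i * x i) = ρ (diagTensor x) := by
  have h : diagTensor (fun i => s i * x i) = diagTensor s * diagTensor x := by
    rw [diagTensor, diagTensor, diagTensor, diagonal_mul_diagonal]
    simp
  rw [h, hρ.map_unitary_mul]
  refine diagonal_mem_unitaryGroup fun i => ?_
  rw [RCLike.star_def, Complex.conj_ofReal, ← Complex.ofReal_mul, hs, Complex.ofReal_one]

/-- The norm of a diagonal tensor with decreasing nonnegative diagonal is attained by a functional
with decreasing nonnegative weights. -/
lemma exists_weights {x : Fin (tensorDim I) → ℝ} (hx : Antitone x) (hx0 : ∀ i, 0 ≤ x i) :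
    ∃ w : Fin (tensorDim I) → ℝ, Antitone w ∧ (∀ i, 0 ≤ w i) ∧
      ρ (diagTensor x) ≤ ∑ i, w i * x i ∧ ∀ y, ∑ i, w i * y i ≤ ρ (diagTensor y) := by
  by_cases hx00 : x = 0
  · refine ⟨0, antitone_const, by simp, ?_, by simp⟩
    have : (diagTensor x : SquareTensor I) = 0 := by
      subst hx00
      ext i j
      simp [diagTensor, diagonal_apply]
    simp [this]
  set Φ : (Fin (tensorDim I) → ℝ) → ℝ := fun y => ρ (diagTensor y) with hΦ
  have hsmul : ∀ (c : ℝ) y, Φ (c • y) = |c| * Φ y := by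
    intro c y
    have : (diagTensor (c • y) : SquareTensor I) = (c : ℂ) • diagTensor y := by
      ext i j
      simp [diagTensor, diagonal_apply]
    rw [hΦ]
    simp only [this, map_smul_eq_mul, Complex.norm_real, Real.norm_eq_abs]
  have hadd : ∀ y z, Φ (y + z) ≤ Φ y + Φ z := by
    intro y z
    have : (diagTensor (y + z) : SquareTensor I) = diagTensor y + diagTensor z := by
      ext i j
      simp only [diagTensor, diagonal_apply, Matrix.add_apply]
      split_ifs <;> simp
    rw [hΦ]
    simp only [this]
    exact map_add_le_add ρ _ _
  have hΦ0 : ∀ y, 0 ≤ Φ y := fun y => apply_nonneg ρ _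
  -- Hahn–Banach: a functional dominated by `Φ` and equal to it at `x`.
  obtain ⟨ℓ, hℓx, hℓ⟩ := exists_extension_of_le_sublinear
    (LinearPMap.mkSpanSingleton x (Φ x) hx00 : (Fin (tensorDim I) → ℝ) →ₗ.[ℝ] ℝ) Φ
    (fun c hc y => by rw [hsmul, abs_of_pos hc]) hadd (by
      rintro ⟨y, hy⟩
      obtain ⟨c, rfl⟩ := Submodule.mem_span_singleton.1 hy
      rw [LinearPMap.mkSpanSingleton'_apply, hsmul]
      exact mul_le_mul_of_nonneg_right (le_abs_self c) (hΦ0 x))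
  have hℓx' : ℓ x = Φ x := by
    have := hℓx ⟨x, Submodule.mem_span_singleton_self x⟩
    rw [this]
    exact LinearPMap.mkSpanSingleton_apply ℝ ℝ hx00 _
  set c : Fin (tensorDim I) → ℝ := fun i => ℓ (Pi.single i 1) with hc
  have hℓsum : ∀ y, ℓ y = ∑ i, c i * y i := by
    intro y
    conv_lhs => rw [← Finset.univ_sum_single y]
    rw [map_sum]
    refine Finset.sum_congr rfl fun i _ => ?_
    have : (Pi.single i (y i) : Fin (tensorDim I) → ℝ) = y i • Pi.single i 1 := by
      rw [← Pi.single_smul, smul_eq_mul, mul_one]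
    rw [this, map_smul, smul_eq_mul, mul_comm]
  set σ := Tuple.sort fun i => -|c i| with hσ
  have hanti : Antitone fun i => |c (σ i)| := by
    intro i j hij
    have := Tuple.monotone_sort (fun i => -|c i|) hij
    simpa using this
  refine ⟨fun i => |c (σ i)|, hanti, fun i => abs_nonneg _, ?_, ?_⟩
  · have hmono : Monovary (fun i => |c (σ i)|) x := fun i j hij => by
      have : j ≤ i := by
        by_contra! h
        exact absurd (hx h.le) (not_le.2 hij)
      exact hanti this
    have := hmono.sum_comp_perm_mul_le_sum_mul (σ := σ.symm)
    simp only [Equiv.apply_symm_apply] at this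
    refine le_trans ?_ this
    change Φ x ≤ _
    rw [← hℓx', hℓsum]
    exact Finset.sum_le_sum fun i _ => mul_le_mul_of_nonneg_right (le_abs_self _) (hx0 i)
  · intro y
    -- The signs and the sorting are moved onto `y`, where `Φ` does not see them.
    set s : Fin (tensorDim I) → ℝ := fun i => if 0 ≤ c i then 1 else -1 with hs
    have h1 : ∑ i, |c (σ i)| * y i = ℓ fun j => s j * y (σ.symm j) := by
      rw [hℓsum, ← Equiv.sum_comp σ.symm]
      refine Finset.sum_congr rfl fun j _ => ?_
      simp only [Equiv.apply_symm_apply, hs]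
      split_ifs with h
      · rw [abs_of_nonneg h]; ring
      · rw [abs_of_neg (not_le.1 h)]; ring
    rw [h1]
    refine (hℓ _).trans_eq ?_
    rw [hΦ]
    simp only
    rw [hρ.map_diagTensor_sign (s := s) (fun i => by simp only [hs]; split_ifs <;> norm_num)
      (fun j => y (σ.symm j)), hρ.map_diagTensor_perm]

end IsUnitarilyInvariantNorm

/-! ### Ky Fan norms -/

/-- The parameters of the linear functionals defining the `k`-th Ky Fan norm. -/
abbrev KyFanIndex (I : Fin N → ℕ) (k : ℕ) : Type :=
  unitaryGroup ((j : Fin N) → Fin (I j)) ℂ × unitaryGroup ((j : Fin N) → Fin (I j)) ℂ ×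
    {d : ((j : Fin N) → Fin (I j)) → ℝ // (∀ i, 0 ≤ d i) ∧ (∀ i, d i ≤ 1) ∧ ∑ i, d i ≤ k}

/-- The linear functional `X ↦ Tr(X U diag(d) W)`. -/
noncomputable def kyFanFunctional {k : ℕ} (q : KyFanIndex I k) : SquareTensor I →ₗ[ℂ] ℂ :=
  (traceLinearMap _ ℂ ℂ).comp (LinearMap.mulRight ℂ
    ((q.1 : SquareTensor I) * diagonal (fun i => (q.2.2.1 i : ℂ)) * (q.2.1 : SquareTensor I)))

lemma kyFanFunctional_apply {k : ℕ} (q : KyFanIndex I k) (X : SquareTensor I) :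
    kyFanFunctional q X = (X * (q.1 : SquareTensor I) * diagonal (fun i => (q.2.2.1 i : ℂ)) *
      (q.2.1 : SquareTensor I)).trace := by
  simp [kyFanFunctional, Matrix.mul_assoc]

/-- The `k`-th Ky Fan norm. -/
noncomputable def kyFan (I : Fin N → ℕ) (k : ℕ) : Seminorm ℂ (SquareTensor I) :=
  ⨆ q : KyFanIndex I k, (normSeminorm ℂ ℂ).comp (kyFanFunctional q)

instance (k : ℕ) : Nonempty (KyFanIndex I k) :=
  ⟨1, 1, 0, by simp, by simp, by simp⟩

/-- A supremum of seminorms is pointwise only for a bounded family. Here entries of unitaries and of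
`d` have modulus at most `1`. -/
lemma bddAbove_kyFan (k : ℕ) : BddAbove (Set.range fun q : KyFanIndex I k =>
    (normSeminorm ℂ ℂ).comp (kyFanFunctional q)) := by
  rw [Seminorm.bddAbove_range_iff]
  intro X
  refine ⟨∑ i : (j : Fin N) → Fin (I j), ∑ _j : (j : Fin N) → Fin (I j), ∑ l, ‖X i l‖, ?_⟩
  rintro _ ⟨⟨U, W, d, hd0, hd1, hd⟩, rfl⟩
  simp only [Seminorm.comp_apply, coe_normSeminorm, kyFanFunctional_apply]
  simp only [trace, diag_apply, mul_apply (N := (W : SquareTensor I)), mul_diagonal]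
  refine (norm_sum_le _ _).trans (Finset.sum_le_sum fun i _ => ?_)
  refine (norm_sum_le _ _).trans (Finset.sum_le_sum fun j _ => ?_)
  rw [mul_apply, norm_mul, norm_mul]
  have h1 : ‖∑ l, X i l * (U : SquareTensor I) l j‖ ≤ ∑ l, ‖X i l‖ := by
    refine (norm_sum_le _ _).trans (Finset.sum_le_sum fun l _ => ?_)
    rw [norm_mul]
    exact mul_le_of_le_one_right (norm_nonneg _) (entry_norm_bound_of_unitary U.2 _ _)
  have h2 : ‖(d j : ℂ)‖ ≤ 1 := by
    rw [Complex.norm_real, Real.norm_eq_abs, abs_of_nonneg (hd0 j)]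
    exact hd1 j
  have h3 := entry_norm_bound_of_unitary W.2 j i
  exact (mul_le_of_le_one_right (by positivity) h3).trans
    ((mul_le_of_le_one_right (by positivity) h2).trans h1)

lemma kyFan_apply (k : ℕ) (X : SquareTensor I) :
    kyFan I k X = ⨆ q : KyFanIndex I k, ‖kyFanFunctional q X‖ :=
  Seminorm.iSup_apply (bddAbove_kyFan k)

lemma norm_kyFanFunctional_le {k : ℕ} (q : KyFanIndex I k) (X : SquareTensor I) :
    ‖kyFanFunctional q X‖ ≤ kyFan I k X := by
  rw [kyFan_apply]
  exact le_ciSup (Seminorm.bddAbove_range_iff.1 (bddAbove_kyFan k) X) q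

/-- The factor `V` is absorbed into the unitary parameter, so the family of functionals is mapped
into itself. -/
lemma kyFan_mul_unitary_le (k : ℕ) (X : SquareTensor I) {V : SquareTensor I}
    (hV : V ∈ unitaryGroup ((j : Fin N) → Fin (I j)) ℂ) : kyFan I k (X * V) ≤ kyFan I k X := by
  rw [kyFan_apply]
  refine ciSup_le fun q => ?_
  refine le_of_eq_of_le (congrArg norm ?_)
    (norm_kyFanFunctional_le (⟨⟨V, hV⟩ * q.1, q.2⟩ : KyFanIndex I k) X)
  rw [kyFanFunctional_apply, kyFanFunctional_apply]
  simp [Matrix.mul_assoc]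

lemma kyFan_unitary_mul_le (k : ℕ) (X : SquareTensor I) {V : SquareTensor I}
    (hV : V ∈ unitaryGroup ((j : Fin N) → Fin (I j)) ℂ) : kyFan I k (V * X) ≤ kyFan I k X := by
  rw [kyFan_apply]
  refine ciSup_le fun q => ?_
  refine le_of_eq_of_le (congrArg norm ?_)
    (norm_kyFanFunctional_le (⟨q.1, q.2.1 * ⟨V, hV⟩, q.2.2⟩ : KyFanIndex I k) X)
  rw [kyFanFunctional_apply, kyFanFunctional_apply, Matrix.mul_assoc, Matrix.mul_assoc,
    Matrix.mul_assoc, trace_mul_comm]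
  simp [Matrix.mul_assoc]

lemma isUnitarilyInvariantNorm_kyFan (k : ℕ) : IsUnitarilyInvariantNorm (kyFan I (k + 1)) where
  eq_zero_of_map_eq_zero X hX := by
    ext b a
    -- This functional reads off the entry `X b a`; its `d` has sum `1`, which is why the index is
    -- `k + 1`.
    have key := norm_kyFanFunctional_le (⟨1, ⟨_, permMatrix_mem_unitaryGroup (Equiv.swap a b)⟩,
      Pi.single a 1, fun i => ?_, fun i => ?_, ?_⟩ : KyFanIndex I (k + 1)) X
    · rw [hX, kyFanFunctional_apply] at key
      have h0 := norm_le_zero_iff.1 key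
      simp only [Equiv.Perm.permMatrix, OneMemClass.coe_one, Matrix.mul_one,
        PEquiv.mul_toMatrix_toPEquiv, trace, diag_apply, submatrix_apply, id_eq, mul_diagonal,
        Equiv.symm_swap] at h0
      rw [Finset.sum_eq_single b] at h0
      · simpa using h0
      · intro i _ hi
        have : Equiv.swap a b i ≠ a := fun h => hi (by
          exact (Equiv.swap a b).injective (h.trans (Equiv.swap_apply_right a b).symm))
        simp [Pi.single_eq_of_ne this]
      · simp
    · by_cases h : i = a
      · subst h; simp
      · simp [h]
    · by_cases h : i = a
      · subst h; simp
      · simp [h]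
    · simp
  map_mul_unitary X U hU := by
    refine le_antisymm (kyFan_mul_unitary_le _ X hU) ?_
    have := kyFan_mul_unitary_le (k + 1) (X * U) (Unitary.star_mem hU)
    rwa [Matrix.mul_assoc, mem_unitaryGroup_iff.1 hU, Matrix.mul_one] at this
  map_unitary_mul X U hU := by
    refine le_antisymm (kyFan_unitary_mul_le _ X hU) ?_
    have := kyFan_unitary_mul_le (k + 1) (U * X) (Unitary.star_mem hU)
    rwa [← Matrix.mul_assoc, mem_unitaryGroup_iff'.1 hU, Matrix.one_mul] at this

/-- Upper bound: `2|U i j||W j i| ≤ |U i j|² + |W j i|²`, and rows and columns of unitaries have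
norm `1`, so the coefficients `c i` lie in `[0, 1]` with sum at most `k + 1`. Equality: identity
unitaries and the indicator of the first `k + 1` indices. -/
lemma kyFan_diagTensor {k : ℕ} (hk : k + 1 ≤ tensorDim I) {x : Fin (tensorDim I) → ℝ}
    (hx : Antitone x) (hx0 : ∀ i, 0 ≤ x i) :
    kyFan I (k + 1) (diagTensor x) = ∑ i : Fin (tensorDim I) with i.val < k + 1, x i := by
  apply le_antisymm
  · rw [kyFan_apply]
    refine ciSup_le ?_
    rintro ⟨U, W, d, hd0, hd1, hd⟩
    rw [kyFanFunctional_apply, diagTensor, trace_diagonal_mul_mul_diagonal_mul]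
    set c : ((j : Fin N) → Fin (I j)) → ℝ := fun i =>
      ∑ j, d j * ((‖(U : SquareTensor I) i j‖ ^ 2 + ‖(W : SquareTensor I) j i‖ ^ 2) / 2) with hc
    have hterm : ∀ i, ‖∑ j, (U : SquareTensor I) i j * (d j : ℂ) * (W : SquareTensor I) j i‖ ≤ c i := by
      intro i
      refine (norm_sum_le _ _).trans (Finset.sum_le_sum fun j _ => ?_)
      rw [norm_mul, norm_mul, Complex.norm_real, Real.norm_eq_abs, abs_of_nonneg (hd0 j)]
      have := two_mul_le_add_sq ‖(U : SquareTensor I) i j‖ ‖(W : SquareTensor I) j i‖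
      nlinarith [hd0 j, mul_le_mul_of_nonneg_left this (hd0 j)]
    have hc0 : ∀ i, 0 ≤ c i := fun i =>
      Finset.sum_nonneg fun j _ => mul_nonneg (hd0 j) (by positivity)
    have hc1 : ∀ i, c i ≤ 1 := by
      intro i
      have h1 : c i ≤ ∑ j, (‖(U : SquareTensor I) i j‖ ^ 2 + ‖(W : SquareTensor I) j i‖ ^ 2) / 2 :=
        Finset.sum_le_sum fun j _ => mul_le_of_le_one_left (by positivity) (hd1 j)
      rw [← Finset.sum_div, Finset.sum_add_distrib, sum_row_normSq_of_unitary U.2,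
        sum_col_normSq_of_unitary W.2] at h1
      linarith
    have hcs : ∑ i, c i ≤ (k + 1 : ℕ) := by
      rw [hc, Finset.sum_comm]
      refine (Finset.sum_le_sum fun j _ => ?_).trans hd
      rw [← Finset.mul_sum, ← Finset.sum_div, Finset.sum_add_distrib,
        sum_col_normSq_of_unitary U.2, sum_row_normSq_of_unitary W.2]
      linarith
    calc _ ≤ ∑ i, x ((multiIndexEquiv I).symm i) * c i := by
          refine (norm_sum_le _ _).trans (Finset.sum_le_sum fun i _ => ?_)
          rw [norm_mul, Complex.norm_real, Real.norm_eq_abs, abs_of_nonneg (hx0 _)]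
          exact mul_le_mul_of_nonneg_left (hterm i) (hx0 _)
      _ = ∑ i, x i * c (multiIndexEquiv I i) := by
          rw [← (multiIndexEquiv I).sum_comp]
          simp
      _ ≤ _ := sum_mul_le_sum_val_lt hk hx hx0 (fun i => hc0 _) (fun i => hc1 _)
          (by rwa [(multiIndexEquiv I).sum_comp])
  · have key := norm_kyFanFunctional_le (⟨1, 1, fun i =>
      if ((multiIndexEquiv I).symm i).val < k + 1 then 1 else 0, fun i => by dsimp only; split_ifs <;> norm_num,
      fun i => by dsimp only; split_ifs <;> norm_num, ?_⟩ : KyFanIndex I (k + 1)) (diagTensor x)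
    · rw [kyFanFunctional_apply, diagTensor] at key
      simp only [OneMemClass.coe_one, Matrix.mul_one, diagonal_mul_diagonal, trace_diagonal] at key
      rw [← (multiIndexEquiv I).sum_comp] at key
      refine le_trans ?_ key
      rw [← Complex.norm_of_nonneg (Finset.sum_nonneg fun i _ => hx0 i), Finset.sum_filter]
      push_cast
      refine le_of_eq (congrArg _ (Finset.sum_congr rfl fun i _ => ?_))
      rw [Equiv.symm_apply_apply]
      split_ifs <;> simp
    · rw [← (multiIndexEquiv I).sum_comp]
      simp only [Equiv.symm_apply_apply]
      rw [← Finset.sum_filter, Finset.sum_const, card_val_lt hk, nsmul_eq_mul, mul_one]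

lemma kyFan_cfc {k : ℕ} (hk : k + 1 ≤ tensorDim I) {H : SquareTensor I} (hH : H.PosSemidef)
    {f : ℝ → ℝ} (hf : MonotoneOn f (Set.Ici 0)) (hf0 : ∀ x, 0 ≤ x → 0 ≤ f x) :
    kyFan I (k + 1) (cfc f H) =
      ∑ i : Fin (tensorDim I) with i.val < k + 1, f (eigenvalueVector hH i) := by
  rw [(isUnitarilyInvariantNorm_kyFan k).map_cfc hH, kyFan_diagTensor hk]
  · exact fun i j hij => hf (eigenvalueVector_nonneg hH j) (eigenvalueVector_nonneg hH i)
      (eigenvalueVector_antitone hH hij)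
  · exact fun i => hf0 _ (eigenvalueVector_nonneg hH i)

lemma continuous_kyFan (k : ℕ) : Continuous (kyFan I k) :=
  Seminorm.continuous_of_finiteDimensional_complex
    -- Tensors are viewed as functions to have a norm at hand.
    (E := ((j : Fin N) → Fin (I j)) → ((j : Fin N) → Fin (I j)) → ℂ) (kyFan I k)

/-- Each eigenvalue is a difference of consecutive Ky Fan norms, which are continuous seminorms.
This supplies measurability in `τ`. -/
lemma continuous_eigenvalueVector {Ω : Type*} [TopologicalSpace Ω] {D : Ω → SquareTensor I}
    (hD : ∀ τ, (D τ).PosSemidef) (hcont : Continuous D) (i : Fin (tensorDim I)) :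
    Continuous fun τ => eigenvalueVector (hD τ) i := by
  have hsum : ∀ k ≤ tensorDim I, Continuous fun τ =>
      ∑ i : Fin (tensorDim I) with i.val < k, eigenvalueVector (hD τ) i := by
    rintro (_ | k) hk
    · simpa using continuous_const
    · refine ((continuous_kyFan (k + 1)).comp hcont).congr fun τ => ?_
      have := kyFan_cfc hk (hD τ) (f := id) (monotone_id.monotoneOn _) (fun x hx => hx)
      rw [cfc_eq_unitary_conj (hD τ)] at this
      simp only [id] at this
      rw [← eq_unitary_conj (hD τ)] at this
      exact this
  refine ((hsum _ i.2).sub (hsum _ i.2.le)).congr fun τ => ?_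
  rw [Pi.sub_apply, sum_val_lt_succ i.2]
  simp

end Tensor

/-! ### Weak log-majorization by geometric means -/

section Scalar

variable {Ω : Type*} [MeasurableSpace Ω] (ν : Measure Ω) [IsProbabilityMeasure ν]

/-- Inequalities between sums of powers pass to sums of logarithms. -/
lemma sum_log_le_of_forall_sum_rpow_le {ι : Type*} {s : Finset ι} (hs : s.Nonempty) {x : ι → ℝ}
    (hx : ∀ i, 0 < x i) {y : ι → Ω → ℝ} (hy : ∀ i, Measurable (y i)) {ε K : ℝ} (hε : 0 < ε)
    (hyε : ∀ i τ, ε ≤ y i τ) (hyK : ∀ i τ, y i τ ≤ K)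
    (h : ∀ p : ℝ, 0 < p → ENNReal.ofReal (∑ i ∈ s, x i ^ p) ≤
      geomMean ν fun τ => ∑ i ∈ s, y i τ ^ p) :
    ∑ i ∈ s, Real.log (x i) ≤ ∑ i ∈ s, ∫ τ, Real.log (y i τ) ∂ν := by
  set T : ℝ := max (max |Real.log ε| |Real.log K|) 1 with hT
  have hT1 : 1 ≤ T := le_max_right _ _
  have hT0 : 0 < T := by linarith
  have hy0 : ∀ i τ, 0 < y i τ := fun i τ => hε.trans_le (hyε i τ)
  have hlogT : ∀ i τ, |Real.log (y i τ)| ≤ T := fun i τ => le_max_of_le_left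
    (abs_le_max_abs_abs (Real.log_le_log hε (hyε i τ)) (Real.log_le_log (hy0 i τ) (hyK i τ)))
  have hlogint : ∀ i, Integrable (fun τ => Real.log (y i τ)) ν := fun i =>
    integrable_log_of_le_of_le ν (hy i) hε (hyε i) (hyK i)
  set n : ℝ := (s.card : ℝ) with hn
  have hn0 : 0 < n := by simpa [hn] using hs.card_pos
  refine le_of_forall_pos_le_add fun δ hδ => ?_
  obtain ⟨p, hp0, hpT, hpδ⟩ : ∃ p : ℝ, 0 < p ∧ p * T ≤ 1 ∧ p * (n * T ^ 2) ≤ δ := by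
    -- `p * T ≤ 1` permits `exp t ≤ 1 + t + t ^ 2` at `t = p * log (y i τ)`; the second bound makes
    -- the resulting error at most `δ`.
    refine ⟨min (1 / T) (δ / (n * T ^ 2)), by positivity, ?_, ?_⟩
    · rw [← le_div_iff₀ hT0]; exact min_le_left _ _
    · rw [← le_div_iff₀ (by positivity)]; exact min_le_right _ _
  have hS : ∀ τ, 0 < ∑ i ∈ s, y i τ ^ p := fun τ =>
    Finset.sum_pos (fun i _ => Real.rpow_pos_of_pos (hy0 i τ) p) hs
  have hSmeas : Measurable fun τ => ∑ i ∈ s, y i τ ^ p :=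
    Finset.measurable_sum s fun i _ => (hy i).pow_const p
  have hSint : Integrable (fun τ => Real.log (∑ i ∈ s, y i τ ^ p)) ν := by
    refine integrable_log_of_le_of_le ν hSmeas (ε := n * ε ^ p) (K := n * K ^ p) (by positivity)
      (fun τ => ?_) (fun τ => ?_)
    · rw [hn, ← nsmul_eq_mul]
      exact Finset.card_nsmul_le_sum _ _ _ fun i _ => Real.rpow_le_rpow hε.le (hyε i τ) hp0.le
    · rw [hn, ← nsmul_eq_mul]
      exact Finset.sum_le_card_nsmul _ _ _ fun i _ =>
        Real.rpow_le_rpow (hy0 i τ).le (hyK i τ) hp0.le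
  have h1 := h p hp0
  rw [geomMean_eq_of_integrable ν (Filter.Eventually.of_forall hS) hSint,
    ENNReal.ofReal_le_ofReal_iff (Real.exp_nonneg _)] at h1
  -- the arithmetic mean dominates the geometric mean
  have h2 : n * Real.exp (p / n * ∑ i ∈ s, Real.log (x i)) ≤ ∑ i ∈ s, x i ^ p := by
    set m := p / n * ∑ i ∈ s, Real.log (x i) with hm
    have hterm : ∀ i ∈ s, Real.exp m * (1 + (p * Real.log (x i) - m)) ≤ x i ^ p := by
      intro i _
      have e : x i ^ p = Real.exp m * Real.exp (p * Real.log (x i) - m) := by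
        rw [← Real.exp_add, Real.rpow_def_of_pos (hx i)]
        ring_nf
      rw [e]
      refine mul_le_mul_of_nonneg_left ?_ (Real.exp_nonneg m)
      linarith [Real.add_one_le_exp (p * Real.log (x i) - m)]
    refine le_trans (le_of_eq ?_) (Finset.sum_le_sum hterm)
    rw [← Finset.mul_sum, Finset.sum_add_distrib, Finset.sum_sub_distrib, ← Finset.mul_sum,
      Finset.sum_const, Finset.sum_const, nsmul_eq_mul, nsmul_eq_mul, ← hn, hm]
    field_simp
    ring
  have h3 : Real.log n + p / n * ∑ i ∈ s, Real.log (x i) ≤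
      ∫ τ, Real.log (∑ i ∈ s, y i τ ^ p) ∂ν := by
    have := Real.log_le_log (by positivity) (h2.trans h1)
    rwa [Real.log_mul hn0.ne' (Real.exp_pos _).ne', Real.log_exp, Real.log_exp] at this
  -- Quadratic bound for each power, then `log z ≤ z - 1` for `z` the average of the powers.
  have h4 : ∀ τ, Real.log (∑ i ∈ s, y i τ ^ p) ≤
      (Real.log n + p ^ 2 * T ^ 2) + p / n * ∑ i ∈ s, Real.log (y i τ) := by
    intro τ
    have hterm : ∀ i ∈ s, y i τ ^ p ≤ 1 + p * Real.log (y i τ) + p ^ 2 * T ^ 2 := by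
      intro i _
      rw [Real.rpow_def_of_pos (hy0 i τ), mul_comm (Real.log (y i τ))]
      have hab : |p * Real.log (y i τ)| ≤ p * T := by
        rw [abs_mul, abs_of_pos hp0]
        exact mul_le_mul_of_nonneg_left (hlogT i τ) hp0.le
      have h5 := Real.abs_exp_sub_one_sub_id_le (hab.trans hpT)
      have h6 : (p * Real.log (y i τ)) ^ 2 ≤ (p * T) ^ 2 := sq_le_sq' (abs_le.1 hab).1 (abs_le.1 hab).2
      linarith [(abs_le.1 h5).2, mul_pow p T 2]
    have h7 := Finset.sum_le_sum hterm
    rw [Finset.sum_add_distrib, Finset.sum_add_distrib, ← Finset.mul_sum, Finset.sum_const,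
      Finset.sum_const, nsmul_eq_mul, nsmul_eq_mul, ← hn] at h7
    have h8 := Real.log_le_sub_one_of_pos (div_pos (hS τ) hn0)
    rw [Real.log_div (hS τ).ne' hn0.ne'] at h8
    have h9 : (∑ i ∈ s, y i τ ^ p) / n ≤
        1 + p / n * ∑ i ∈ s, Real.log (y i τ) + p ^ 2 * T ^ 2 := by
      rw [div_le_iff₀ hn0]
      refine h7.trans (le_of_eq ?_)
      field_simp
    linarith
  have hsum : Integrable (fun τ => ∑ i ∈ s, Real.log (y i τ)) ν :=
    integrable_finsetSum _ fun i _ => hlogint i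
  have h5 := integral_mono hSint
    ((integrable_const (Real.log n + p ^ 2 * T ^ 2)).add (hsum.const_mul (p / n))) h4
  simp only [Pi.add_apply] at h5
  rw [integral_add (integrable_const _) (hsum.const_mul _), integral_const_mul,
    integral_finsetSum _ fun i _ => hlogint i] at h5
  simp only [integral_const, probReal_univ, one_smul] at h5
  -- The terms `log n` cancel, and dividing the error `p ^ 2 * T ^ 2` by `p / n` leaves `p * (n * T
  -- ^ 2)`.
  have h6 : p / n * (∑ i ∈ s, Real.log (x i) - ∑ i ∈ s, ∫ τ, Real.log (y i τ) ∂ν) ≤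
      p / n * (p * (n * T ^ 2)) := by
    have : p / n * (p * (n * T ^ 2)) = p ^ 2 * T ^ 2 := by field_simp
    rw [this]
    linarith
  have h7 := le_of_mul_le_mul_left h6 (by positivity)
  linarith

variable {r : ℕ} {a : Fin r → ℝ} {v : Fin r → Ω → ℝ} {K : ℝ}

/-- Perturbed logarithmic inequalities imply weak log-majorization. -/
lemma weakLogMajorized_of_forall_sum_log_le (ha0 : ∀ i, 0 ≤ a i) (hv : ∀ i, Measurable (v i))
    (hv0 : ∀ i τ, 0 ≤ v i τ) (hK : ∀ i τ, v i τ ≤ K)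
    (h : ∀ k, k + 1 ≤ r → ∀ ε : ℝ, 0 < ε →
      ∑ i : Fin r with i.val < k + 1, Real.log (ε + a i) ≤
        ∑ i : Fin r with i.val < k + 1, ∫ τ, Real.log (ε + v i τ) ∂ν) :
    WeakLogMajorized (fun i => ENNReal.ofReal (a i)) (fun i => geomMean ν (v i)) := by
  intro k hk1 hkr
  obtain ⟨k, rfl⟩ : ∃ j, k = j + 1 := ⟨k - 1, by omega⟩
  have hlim1 : Filter.Tendsto (fun n : ℕ => ∏ i : Fin r with i.val < k + 1,
      ENNReal.ofReal (a i + 1 / ((n : ℝ) + 1))) Filter.atTop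
      (nhds (∏ i : Fin r with i.val < k + 1, ENNReal.ofReal (a i))) := by
    refine ENNReal.tendsto_finsetProd_of_ne_top _ (fun i _ => ?_) (by simp)
    refine (ENNReal.continuous_ofReal.tendsto _).comp ?_
    simpa using (tendsto_const_nhds (x := a i)).add tendsto_one_div_add_atTop_nhds_zero_nat
  have hlim2 : Filter.Tendsto (fun n : ℕ => ∏ i : Fin r with i.val < k + 1,
      geomMean ν fun τ => v i τ + 1 / ((n : ℝ) + 1)) Filter.atTop
      (nhds (∏ i : Fin r with i.val < k + 1, geomMean ν (v i))) :=
    ENNReal.tendsto_finsetProd_of_ne_top _ (fun i _ => tendsto_geomMean_add ν (hv i) (hK i))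
      fun i _ => geomMean_ne_top ν (hK i)
  refine le_of_tendsto_of_tendsto' hlim1 hlim2 fun n => ?_
  set ε : ℝ := 1 / ((n : ℝ) + 1) with hε
  have hε0 : 0 < ε := by positivity
  have e1 : ∏ i : Fin r with i.val < k + 1, ENNReal.ofReal (a i + ε) =
      ENNReal.ofReal (Real.exp (∑ i : Fin r with i.val < k + 1, Real.log (ε + a i))) := by
    rw [Real.exp_sum, ENNReal.ofReal_prod_of_nonneg fun i _ => Real.exp_nonneg _]
    refine Finset.prod_congr rfl fun i _ => ?_
    rw [Real.exp_log (by linarith [ha0 i]), add_comm]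
  have e2 : ∏ i : Fin r with i.val < k + 1, geomMean ν (fun τ => v i τ + ε) =
      ENNReal.ofReal (Real.exp
        (∑ i : Fin r with i.val < k + 1, ∫ τ, Real.log (ε + v i τ) ∂ν)) := by
    rw [Real.exp_sum, ENNReal.ofReal_prod_of_nonneg fun i _ => Real.exp_nonneg _]
    refine Finset.prod_congr rfl fun i _ => ?_
    simp only [add_comm _ ε]
    exact geomMean_eq_of_integrable ν (Filter.Eventually.of_forall fun τ => by linarith [hv0 i τ])
      (integrable_log_of_le_of_le ν ((hv i).const_add ε) hε0 (fun τ => by linarith [hv0 i τ])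
        (K := ε + K) fun τ => by linarith [hK i τ])
  rw [e1, e2]
  exact ENNReal.ofReal_le_ofReal (Real.exp_le_exp.2 (h k hkr ε hε0))

/-- Weak log-majorization by geometric means, tested with decreasing weights. -/
lemma sum_mul_le_of_weakLogMajorized_geomMean (ha : Antitone a) (ha0 : ∀ i, 0 ≤ a i)
    (hK : ∀ i τ, v i τ ≤ K)
    (h : WeakLogMajorized (fun i => ENNReal.ofReal (a i)) (fun i => geomMean ν (v i)))
    {g : ℝ → ℝ} (hg : ContinuousOn g (Set.Ici 0))
    (hc : ConvexOn ℝ Set.univ fun x => g (Real.exp x)) {w : Fin r → ℝ} (hw : Antitone w)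
    (hw0 : ∀ i, 0 ≤ w i) :
    ∑ i, w i * g (a i) ≤ ∑ i, w i * g (geomMean ν (v i)).toReal := by
  have hab : ∀ k ≤ r, ∏ i : Fin r with i.val < k, a i ≤
      ∏ i : Fin r with i.val < k, (geomMean ν (v i)).toReal := by
    intro k hk
    rcases Nat.eq_zero_or_pos k with rfl | hk0
    · simp
    have h1 := ENNReal.toReal_mono (ENNReal.prod_ne_top fun i _ => geomMean_ne_top ν (hK i))
      (h k hk0 hk)
    rw [ENNReal.toReal_prod, ENNReal.toReal_prod] at h1
    simpa only [ENNReal.toReal_ofReal (ha0 _)] using h1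
  have key := sum_mul_nonneg_of_partial_sums le_rfl (w := w)
    (t := fun i => g (geomMean ν (v i)).toReal - g (a i)) (fun i j hij _ => hw hij)
    (fun i _ => hw0 i) fun j hj => by
      rw [Finset.sum_sub_distrib, sub_nonneg]
      exact sum_le_sum_of_weakLogMajorized ha ha0 (fun i => ENNReal.toReal_nonneg) hab hg hc j hj
  rw [Finset.filter_true_of_mem fun i _ => i.2] at key
  simp only [mul_sub, Finset.sum_sub_distrib] at key
  linarith

end Scalar

theorem mainTheorem6 {N : ℕ} (I : Fin N → ℕ)
    {Ω : Type*} [MetricSpace Ω] [SigmaCompactSpace Ω] [MeasurableSpace Ω] [BorelSpace Ω]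
    (ν : Measure Ω) [IsProbabilityMeasure ν]
    (C : SquareTensor I) (D : Ω → SquareTensor I)
    (hC : C.PosSemidef) (hD : ∀ τ, (D τ).PosSemidef)
    (hD_cont : Continuous D)
    (hD_bdd : BddAbove (Set.range fun τ => frobeniusNorm (D τ))) :
    List.TFAE [
      WeakLogMajorized
        (fun i => ENNReal.ofReal (eigenvalueVector hC i))
        (fun i => EReal.exp (extIntegral ν fun τ => extLog (eigenvalueVector (hD τ) i))),
      ∀ f : ℝ → ℝ, ContinuousOn f (Set.Ici 0) → (∀ x, 0 ≤ x → 0 ≤ f x) → ConvexLogExp f →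
        ∀ ρ : Seminorm ℂ (SquareTensor I), IsUnitarilyInvariantNorm ρ →
          ENNReal.ofReal (ρ (cfc f C)) ≤
            EReal.exp (extIntegral ν fun τ => extLog (ρ (cfc f (D τ)))),
      ∀ g : ℝ → ℝ, ContinuousOn g (Set.Ici 0) → (∀ x, 0 ≤ x → 0 ≤ g x) →
        ConvexOn ℝ Set.univ (fun x => g (Real.exp x)) →
        ∀ ρ : Seminorm ℂ (SquareTensor I), IsUnitarilyInvariantNorm ρ →
          ENNReal.ofReal (ρ (cfc g C)) ≤ ∫⁻ τ, ENNReal.ofReal (ρ (cfc g (D τ))) ∂ν] := by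
  obtain ⟨K, hKbound⟩ := hD_bdd
  set a := eigenvalueVector hC with ha_def
  set v : Fin (tensorDim I) → Ω → ℝ := fun i τ => eigenvalueVector (hD τ) i with hv_def
  have ha : Antitone a := eigenvalueVector_antitone hC
  have ha0 : ∀ i, 0 ≤ a i := eigenvalueVector_nonneg hC
  have hv : ∀ i, Measurable (v i) := fun i => (continuous_eigenvalueVector hD hD_cont i).measurable
  have hv0 : ∀ i τ, 0 ≤ v i τ := fun i τ => eigenvalueVector_nonneg (hD τ) i
  have hK : ∀ i τ, v i τ ≤ K := fun i τ =>
    (eigenvalueVector_le_frobeniusNorm (hD τ) i).trans (hKbound ⟨τ, rfl⟩)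
  -- Common to 1 → 2 and 1 → 3: the weights are chosen for `C` alone, so they do not depend on `τ`.
  have weights : ∀ {g : ℝ → ℝ}, ContinuousOn g (Set.Ici 0) → (∀ x, 0 ≤ x → 0 ≤ g x) →
      ConvexOn ℝ Set.univ (fun x => g (Real.exp x)) →
      ∀ ρ : Seminorm ℂ (SquareTensor I), IsUnitarilyInvariantNorm ρ →
      WeakLogMajorized (fun i => ENNReal.ofReal (a i)) (fun i => geomMean ν (v i)) →
      ∃ w : Fin (tensorDim I) → ℝ, (∀ i, 0 ≤ w i) ∧
        ENNReal.ofReal (ρ (cfc g C)) ≤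
          ∑ i, ENNReal.ofReal (w i) * ENNReal.ofReal (g (geomMean ν (v i)).toReal) ∧
        ∀ τ, ∑ i, w i * g (v i τ) ≤ ρ (cfc g (D τ)) := by
    intro g hg hg0 hc ρ hρ hmaj
    have hm := monotoneOn_of_convexOn_comp_exp hg hc
    obtain ⟨w, hw, hw0, hwx, hwy⟩ := hρ.exists_weights (x := fun i => g (a i))
      (fun i j hij => hm (ha0 j) (ha0 i) (ha hij)) (fun i => hg0 _ (ha0 i))
    refine ⟨w, hw0, ?_, fun τ => ?_⟩
    · simp only [← ENNReal.ofReal_mul (hw0 _)]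
      rw [← ENNReal.ofReal_sum_of_nonneg fun i _ => mul_nonneg (hw0 i) (hg0 _ ENNReal.toReal_nonneg),
        hρ.map_cfc hC]
      exact ENNReal.ofReal_le_ofReal (hwx.trans
        (sum_mul_le_of_weakLogMajorized_geomMean ν ha ha0 hK hmaj hg hc hw hw0))
    · rw [hρ.map_cfc (hD τ)]
      exact hwy _
  have gK : ∀ {g : ℝ → ℝ}, ContinuousOn g (Set.Ici 0) →
      ConvexOn ℝ Set.univ (fun x => g (Real.exp x)) → ∀ i τ, g (v i τ) ≤ g K :=
    fun hg hc i τ => monotoneOn_of_convexOn_comp_exp hg hc (hv0 i τ)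
      ((hv0 i τ).trans (hK i τ)) (hK i τ)
  tfae_have 1 → 2 := by
    intro hmaj f hf hf0 hfc ρ hρ
    have hc := hfc.convexOn hf0
    obtain ⟨w, hw0, hle, hwD⟩ := weights hf hf0 hc ρ hρ hmaj
    calc ENNReal.ofReal (ρ (cfc f C)) ≤ _ := hle
      _ ≤ ∑ i, ENNReal.ofReal (w i) * geomMean ν fun τ => f (v i τ) := by
        gcongr with i
        exact apply_geomMean_le_geomMean ν hf hf0 hfc (hv i) (hv0 i) (hK i)
      _ ≤ geomMean ν fun τ => ∑ i, w i * f (v i τ) :=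
        sum_mul_geomMean_le ν _ (v := fun i τ => f (v i τ)) hw0
          (fun i => measurable_comp_of_continuousOn_Ici hf (hv i) (hv0 i))
          (fun i τ => hf0 _ (hv0 i τ)) (gK hf hc)
      _ ≤ _ := geomMean_mono ν hwD
  tfae_have 1 → 3 := by
    intro hmaj g hg hg0 hc ρ hρ
    obtain ⟨w, hw0, hle, hwD⟩ := weights hg hg0 hc ρ hρ hmaj
    have hgm : ∀ i, Measurable fun τ => ENNReal.ofReal (g (v i τ)) := fun i =>
      (measurable_comp_of_continuousOn_Ici hg (hv i) (hv0 i)).ennreal_ofReal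
    calc ENNReal.ofReal (ρ (cfc g C)) ≤ _ := hle
      _ ≤ ∑ i, ENNReal.ofReal (w i) * ∫⁻ τ, ENNReal.ofReal (g (v i τ)) ∂ν := by
        gcongr with i
        exact apply_geomMean_le_lintegral ν hg hg0 hc (hv i) (hv0 i) (hK i)
      _ = ∫⁻ τ, ∑ i, ENNReal.ofReal (w i) * ENNReal.ofReal (g (v i τ)) ∂ν := by
        rw [lintegral_finsetSum _ fun i _ => (hgm i).const_mul _]
        exact Finset.sum_congr rfl fun i _ => (lintegral_const_mul _ (hgm i)).symm
      _ ≤ _ := by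
        refine lintegral_mono fun τ => ?_
        simp only [← ENNReal.ofReal_mul (hw0 _)]
        rw [← ENNReal.ofReal_sum_of_nonneg fun i _ => mul_nonneg (hw0 i) (hg0 _ (hv0 i τ))]
        exact ENNReal.ofReal_le_ofReal (hwD τ)
  tfae_have 2 → 1 := by
    intro h
    refine weakLogMajorized_of_forall_sum_log_le ν ha0 hv hv0 hK fun k hk ε hε => ?_
    refine sum_log_le_of_forall_sum_rpow_le ν ⟨⟨k, hk⟩, by simp⟩
      (fun i => by linarith [ha0 i]) (fun i => (hv i).const_add ε) hε
      (fun i τ => by linarith [hv0 i τ]) (K := ε + K) (fun i τ => by linarith [hK i τ])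
      fun p hp => ?_
    have hf0 : ∀ x : ℝ, 0 ≤ x → 0 ≤ (ε + x) ^ p := fun x hx => Real.rpow_nonneg (by linarith) p
    have hm : MonotoneOn (fun x : ℝ => (ε + x) ^ p) (Set.Ici 0) := fun x hx y _ hxy =>
      Real.rpow_le_rpow (add_nonneg hε.le hx) (by linarith) hp.le
    have := h (fun x => (ε + x) ^ p) (Continuous.continuousOn
      ((continuous_const.add continuous_id).rpow_const fun x => Or.inr hp.le)) hf0
      (convexLogExp_add_rpow hε hp) (kyFan I (k + 1)) (isUnitarilyInvariantNorm_kyFan k)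
    simp only [kyFan_cfc hk hC hm hf0, kyFan_cfc hk (hD _) hm hf0] at this
    exact this
  tfae_have 3 → 1 := by
    intro h
    refine weakLogMajorized_of_forall_sum_log_le ν ha0 hv hv0 hK fun k hk ε hε => ?_
    -- This is `log (ε + x)` made nonnegative by subtracting `log ε`; the constant cancels because
    -- `ν` has mass one.
    set g : ℝ → ℝ := fun x => Real.log (1 + x / ε) with hg_def
    have hg : ContinuousOn g (Set.Ici 0) := by
      refine ContinuousOn.log (by fun_prop) fun x hx => ?_
      have : 0 ≤ x / ε := div_nonneg hx hε.le
      linarith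
    have hg0 : ∀ x : ℝ, 0 ≤ x → 0 ≤ g x := fun x hx =>
      Real.log_nonneg (by linarith [div_nonneg hx hε.le])
    have hc := convexOn_log_one_add_exp_div hε
    have hm := monotoneOn_of_convexOn_comp_exp hg hc
    have h1 := h g hg hg0 hc (kyFan I (k + 1)) (isUnitarilyInvariantNorm_kyFan k)
    simp only [kyFan_cfc hk hC hm hg0, kyFan_cfc hk (hD _) hm hg0] at h1
    have hgeq : ∀ x : ℝ, 0 ≤ x → g x = Real.log (ε + x) - Real.log ε := by
      intro x hx
      rw [hg_def, ← Real.log_div (by linarith) hε.ne', add_div, div_self hε.ne']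
    have hint : ∀ i, Integrable (fun τ => Real.log (ε + v i τ)) ν := fun i =>
      integrable_log_of_le_of_le ν ((hv i).const_add ε) hε (fun τ => by linarith [hv0 i τ])
        (K := ε + K) fun τ => by linarith [hK i τ]
    have hgint : ∀ i, Integrable (fun τ => g (v i τ)) ν := fun i =>
      ((hint i).sub (integrable_const (Real.log ε))).congr
        (Filter.Eventually.of_forall fun τ => (hgeq _ (hv0 i τ)).symm)
    change ENNReal.ofReal (∑ i : Fin (tensorDim I) with i.val < k + 1, g (a i)) ≤
      ∫⁻ τ, ENNReal.ofReal (∑ i : Fin (tensorDim I) with i.val < k + 1, g (v i τ)) ∂ν at h1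
    rw [← ofReal_integral_eq_lintegral_ofReal (integrable_finsetSum _ fun i _ => hgint i)
      (Filter.Eventually.of_forall fun τ => Finset.sum_nonneg fun i _ => hg0 _ (hv0 i τ)),
      ENNReal.ofReal_le_ofReal_iff (integral_nonneg fun τ =>
        Finset.sum_nonneg fun i _ => hg0 _ (hv0 i τ)),
      integral_finsetSum _ fun i _ => hgint i] at h1
    have h2 : ∀ i, ∫ τ, g (v i τ) ∂ν = ∫ τ, Real.log (ε + v i τ) ∂ν - Real.log ε := by
      intro i
      simp only [hgeq _ (hv0 i _)]
      rw [integral_sub (hint i) (integrable_const _)]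
      simp
    simp only [h2, hgeq _ (ha0 _), Finset.sum_sub_distrib] at h1
    linarith
  tfae_finish
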